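/- **Definitions.** Let $X$ be a standard Borel space and let $q\ge 1$ be an integer, identified with the set $\{0,\dots,q-1\}$. Write $[Y]^{<\infty}$ for the space of finite subsets of a standard Borel space $Y$, with its usual Borel structure (the disjoint union over $k$ of the quotients of the spaces of injective $k$-tuples). An $(X,q)$-*constraint* with domain $D=\mathrm{dom}(B)\in[X]^{<\infty}$ is a set $B$ of functions $D\to q$. The constraints form a standard Borel space, where partial functions are identified with their graphs in $[X\times q]^{<\infty}$ and a constraint is given by its domain together with the finite set of its members. A *Borel CSP* $\mathscr B\colon X\to^? q$ is a Borel set of $(X,q)$-constraints. A *Borel solution* to $\mathscr B$ is a Borel function $f\colon X\to q$ such that $f|_{\mathrm{dom}(B)}\notin B$ for all $B\in\mathscr B$. Put $$\mathsf p(\mathscr B)=\sup_{B\in\mathscr B}\frac{|B|}{q^{|\mathrm{dom}(B)|}},\qquad \mathsf d(\mathscr B)=\sup_{B\in\mathscr B}\big|\{B'\in\mathscr B : B'\neq B,\ \mathrm{dom}(B')\cap\mathrm{dom}(B)\neq\varnothing\}\big|\in\mathbb N\cup\{\infty\}$$ (suprema over the empty set are $0$, and $0\cdot\infty=0$). The *shattering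 number* $\mathsf{sh}(\mathscr B)$ is the least $s\in\mathbb N$ for which there is a Borel set $\mathcal P\subseteq[X]^{<\infty}$ that is a partition of $X$ and is such that for each $B\in\mathscr B$ the set $\mathrm{dom}(B)$ meets at most $s$ members of $\mathcal P$ ($\infty$ if there is no such $s$). For a graph $G$ on $X$, the *separation index* $\mathsf{si}(G)$ is the least $s\in\mathbb N$ for which $X$ can be partitioned into Borel sets $U_0,\dots,U_s$ such that all connected components of each induced subgraph $G[U_i]$ are finite ($\infty$ if there is no such $s$). The *asymptotic separation index* is $\mathsf{asi}(G)=\sup_{R\in\mathbb N}\mathsf{si}(G^R)$, where distinct points are adjacent in $G^R$ if and only if they are joined by a path of at most $R$ edges in $G$. Let $G_{\mathscr B}$ be the graph on $X$ in which distinct points are adjacent if and only if they both lie in $\mathrm{dom}(B)$ for some $B\in\mathscr B$. **Theorem.** Let $\mathscr B\colon X\to^? q$ be a Borel CSP on a standard Borel space $X$, where $q\ge1$. 1. Let $s\ge 1$ be an integer with $\mathsf{sh}(\mathscr B)\le s$. If $\mathsf p(\mathscr B)\,(\mathsf d(\mathscr B)+1)^{s}\le e^{-s}$, then $\mathscr B$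 has a Borel solution. 2. If $G_{\mathscr B}$ is a Borel graph (its adjacency relation is a Borel subset of $X^2$), then $\mathsf{sh}(\mathscr B)\le \mathsf{si}(G_{\mathscr B})+1$. 3. Let $s\ge 0$ be an integer with $\mathsf{si}(G_{\mathscr B})\le s$. If $\mathsf p(\mathscr B)\,(\mathsf d(\mathscr B)+1)^{s+1}\le e^{-s-1}$, then $\mathscr B$ has a Borel solution. 4. Suppose that $\mathsf{asi}(G_{\mathscr B})\le 1$. If $\mathsf p(\mathscr B)\,(\mathsf d(\mathscr B)+1)^{2}\le e^{-2}$, then $\mathscr B$ has a Borel solution. -/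

import Mathlib

open scoped ENNReal MeasureTheory

/-- The Borel structure on the space `[X]^{<∞}` of finite subsets of `X`. For every `k` the
`k`-element subsets of `X` carry the quotient σ-algebra of the space of injective `k`-tuples
(under the map sending a tuple to the set of its entries), and `[X]^{<∞}` is the disjoint union of
these spaces over `k`; thus a family of finite sets is measurable iff, for each `k`, the set of
injective `k`-tuples that enumerate a member of the family is measurable. (Mathlib's default
σ-algebra on `Finset X` ignores the σ-algebra of `X` and is not the one meant here; `finsetBorel`
is therefore always passed explicitly and is not an instance.) -/
@[reducible]
def finsetBorel (X : Type*) [MeasurableSpace X] : MeasurableSpace (Finset X) :=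
  ⨅ k : ℕ, MeasurableSpace.map
    (fun x : {x : Fin k → X // Function.Injective x} =>
      (Finset.univ : Finset (Fin k)).map ⟨x.1, x.2⟩) inferInstance

theorem measurableSet_finsetBorel_iff {X : Type*} [MeasurableSpace X] (A : Set (Finset X)) :
    MeasurableSet[finsetBorel X] A ↔ ∀ k : ℕ, MeasurableSet
      {x : {x : Fin k → X // Function.Injective x} |
        (Finset.univ : Finset (Fin k)).map ⟨x.1, x.2⟩ ∈ A} :=
  MeasurableSpace.measurableSet_iInf

/-- A partial function `X ⇀ q` with finite domain, given by its graph. -/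
@[ext]
structure FinPartialFun (X : Type*) (q : ℕ) where
  graph : Finset (X × Fin q)
  functional : ∀ (x : X) (i j : Fin q), (x, i) ∈ graph → (x, j) ∈ graph → i = j

namespace FinPartialFun

/-- The relative σ-algebra inherited from `[X × q]^{<∞}`. -/
instance instMeasurableSpace (X : Type*) [MeasurableSpace X] (q : ℕ) :
    MeasurableSpace (FinPartialFun X q) :=
  MeasurableSpace.comap FinPartialFun.graph (finsetBorel (X × Fin q))

/-- The domain of a finite partial function. -/
def dom {X : Type*} {q : ℕ} (φ : FinPartialFun X q) : Set X :=
  {x | ∃ i : Fin q, (x, i) ∈ φ.graph}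

theorem graphMap_injective {X : Type*} {q : ℕ} (f : X → Fin q) :
    Function.Injective (fun x => (x, f x)) :=
  fun _ _ h => congrArg Prod.fst h

/-- The restriction `f|_D` of a coloring `f : X → q` to a finite set `D ⊆ X`. -/
def restrict {X : Type*} {q : ℕ} (f : X → Fin q) (D : Finset X) : FinPartialFun X q :=
  ⟨D.map ⟨fun x => (x, f x), graphMap_injective f⟩, by
    intro x i j hi hj
    rw [Finset.mem_map] at hi hj
    obtain ⟨y, _, rfl, rfl⟩ := hi
    obtain ⟨z, _, rfl, rfl⟩ := hj
    rfl⟩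

end FinPartialFun

/-- An `(X, q)`-constraint: a finite domain `D ⊆ X` together with a set of (forbidden)
`q`-colorings of `D`. The domain is recorded explicitly, so that it is also meaningful for the
constraint without forbidden colorings. -/
@[ext]
structure CSPConstraint (X : Type*) (q : ℕ) where
  dom : Finset X
  bad : Finset (FinPartialFun X q)
  dom_eq : ∀ φ ∈ bad, φ.dom = (dom : Set X)

namespace CSPConstraint

/-- The Borel structure on the space `Const(X, q)` of all constraints, inherited from
`[X]^{<∞} × [[X ⇀ q]^{<∞}]^{<∞}`. (On constraints with at least one forbidden coloring the first
coordinate is a Borel function of the second one.) -/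
instance instMeasurableSpace (X : Type*) [MeasurableSpace X] (q : ℕ) :
    MeasurableSpace (CSPConstraint X q) :=
  MeasurableSpace.comap (fun B => (B.dom, B.bad))
    ((finsetBorel X).prod (finsetBorel (FinPartialFun X q)))

/-- The coloring `f` violates `B` if its restriction to the domain of `B` is forbidden. -/
def Violates {X : Type*} {q : ℕ} (f : X → Fin q) (B : CSPConstraint X q) : Prop :=
  FinPartialFun.restrict f B.dom ∈ B.bad

/-- The probability `|B| / q^{|dom B|}` that `B` is violated by a uniformly random coloring. -/
noncomputable def prob {X : Type*} {q : ℕ} (B : CSPConstraint X q) : ℝ≥0∞ :=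
  (B.bad.card : ℝ≥0∞) / (q : ℝ≥0∞) ^ B.dom.card

end CSPConstraint

/-- A constraint satisfaction problem on `X` with range `q` is a set of `(X, q)`-constraints. It is
Borel if it is a measurable subset of the space of constraints. -/
abbrev CSP (X : Type*) (q : ℕ) : Type _ := Set (CSPConstraint X q)

namespace CSP

variable {X : Type*} {q : ℕ}

/-- `f` is a solution if it satisfies (does not violate) all constraints. -/
def IsSolution (𝓑 : CSP X q) (f : X → Fin q) : Prop :=
  ∀ B ∈ 𝓑, ¬ B.Violates f

/-- There is a solution `f : X → q` that is a Borel function. -/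
def HasBorelSolution [MeasurableSpace X] (𝓑 : CSP X q) : Prop :=
  ∃ f : X → Fin q, Measurable f ∧ 𝓑.IsSolution f

/-- `p(𝓑)`, the supremum of the probabilities of the constraints. -/
noncomputable def p (𝓑 : CSP X q) : ℝ≥0∞ :=
  ⨆ B ∈ 𝓑, B.prob

/-- `d(𝓑)`, the maximum dependency degree, possibly infinite. -/
noncomputable def d (𝓑 : CSP X q) : ℕ∞ :=
  ⨆ B ∈ 𝓑, Set.encard {B' | B' ∈ 𝓑 ∧ B ≠ B' ∧ ∃ x, x ∈ B'.dom ∧ x ∈ B.dom}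

/-- There is a Borel partition of `X` into finite sets such that the domain of each constraint
meets at most `s` of them. -/
def IsShatteredBy [MeasurableSpace X] (𝓑 : CSP X q) (s : ℕ) : Prop :=
  ∃ 𝓟 : Set (Finset X), MeasurableSet[finsetBorel X] 𝓟 ∧
    Setoid.IsPartition ((fun S : Finset X => (S : Set X)) '' 𝓟) ∧
    ∀ B ∈ 𝓑, Set.encard {S | S ∈ 𝓟 ∧ ∃ x, x ∈ B.dom ∧ x ∈ S} ≤ (s : ℕ∞)

/-- The shattering number `sh(𝓑)`: the least `s` as in `IsShatteredBy`, or `∞` if none exists. -/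
noncomputable def sh [MeasurableSpace X] (𝓑 : CSP X q) : ℕ∞ :=
  ⨅ (s : ℕ) (_ : 𝓑.IsShatteredBy s), (s : ℕ∞)

/-- The graph `G_𝓑` on `X`: distinct points are adjacent iff they lie in the domain of a common
constraint. -/
def graph (𝓑 : CSP X q) : SimpleGraph X where
  Adj x y := x ≠ y ∧ ∃ B ∈ 𝓑, x ∈ B.dom ∧ y ∈ B.dom
  symm := ⟨fun _ _ ⟨hne, B, hB, hx, hy⟩ => ⟨hne.symm, B, hB, hy, hx⟩⟩
  loopless := ⟨fun _ h => h.1 rfl⟩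

end CSP

namespace SimpleGraph

variable {V : Type*}

/-- The adjacency relation is a Borel subset of `V × V`. -/
def IsBorel [MeasurableSpace V] (G : SimpleGraph V) : Prop :=
  MeasurableSet {e : V × V | G.Adj e.1 e.2}

/-- Every connected component is finite. -/
def ComponentFinite (G : SimpleGraph V) : Prop :=
  ∀ C : G.ConnectedComponent, C.supp.Finite

/-- There is a partition of the vertex set into Borel sets `U 0, …, U s` each of which induces a
component-finite subgraph. -/
def IsSeparatedBy [MeasurableSpace V] (G : SimpleGraph V) (s : ℕ) : Prop :=
  ∃ U : Fin (s + 1) → Set V, (∀ i, MeasurableSet (U i)) ∧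
    (∀ i j, i ≠ j → Disjoint (U i) (U j)) ∧ (⋃ i, U i) = Set.univ ∧
    ∀ i, (G.induce (U i)).ComponentFinite

/-- The separation index `si(G)`: the least `s` as in `IsSeparatedBy`, or `∞` if none exists. -/
noncomputable def si [MeasurableSpace V] (G : SimpleGraph V) : ℕ∞ :=
  ⨅ (s : ℕ) (_ : G.IsSeparatedBy s), (s : ℕ∞)

/-- The graph `G^R`: distinct vertices are adjacent iff they are joined by a path with at most `R`
edges in `G`. -/
def distPower (G : SimpleGraph V) (R : ℕ) : SimpleGraph V where
  Adj u v := u ≠ v ∧ ∃ w : G.Walk u v, w.IsPath ∧ w.length ≤ R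
  symm := ⟨fun _ _ ⟨hne, w, hw, hR⟩ =>
    ⟨hne.symm, w.reverse, hw.reverse, by rwa [Walk.length_reverse]⟩⟩
  loopless := ⟨fun _ h => h.1 rfl⟩

/-- The asymptotic separation index `asi(G)`. -/
noncomputable def asi [MeasurableSpace V] (G : SimpleGraph V) : ℕ∞ :=
  ⨆ R : ℕ, (G.distPower R).si

end SimpleGraph

/-! Sequential colouring by conditional probabilities. Put K = e(d+1). Given a Borel partition of X
into finite classes such that every constraint meets at most s of them, number the classes so that
distinct classes met by a common constraint get distinct numbers. At stage n all classes numbered n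
are coloured at once. Call the weight of a constraint its probability of being violated when the
colours so far are kept and the rest are uniform. Colouring a class uniformly preserves the mean
weight, so by Markov the weight grows by a factor K or more with probability at most 1/K, and the
finite Lovász Local Lemma gives a colouring of the class for which this happens to no constraint
meeting it. No constraint meets two classes of one stage, so the classes do not interfere. After at
most s increases the weight of a constraint is zero or below p K^s ≤ 1, whereas a violated, fully
coloured constraint has weight at least 1.

The choices are Borel because each class takes the first successful member of a fixed sequence of
Borel colourings that realizes every colouring of every finite set (`exists_seq_measurable_dense`).
All quantifiers involved range over finite sections, so Borelness follows from
`measurableSet_exists_of_finite`, which rests on Novikov's separation theorem.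

For the separation index, the components inside the s+1 pieces form such a partition: the domain of
a constraint is a clique, so it meets at most one component of each piece. If d is infinite, the
numerical hypothesis forces p = 0, and nothing is forbidden. The asymptotic statement is the case s
= 1, as the first distance power of a graph is the graph itself. -/

/-! ### Novikov separation, projections with finite sections, dense sequences of Borel sets and
colourings. -/

namespace MeasureTheory

/-- A sequence of sets is Borel-separated if its members are contained in measurable sets with
empty intersection. -/
def SeqMeasurablySeparable {α : Type*} [MeasurableSpace α] (s : ℕ → Set α) : Prop :=
  ∃ t : ℕ → Set α, (∀ n, s n ⊆ t n) ∧ (∀ n, MeasurableSet (t n)) ∧ ⋂ n, t n = ∅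

/-- Unite the separators at position `i` and intersect them elsewhere: a common point would lie in
`t j i` for some `j`, hence in every `t j n` for that `j`. -/
theorem SeqMeasurablySeparable.of_iUnion {α : Type*} [MeasurableSpace α] {s : ℕ → Set α} (i : ℕ)
    {v : ℕ → ℕ → Set α} (hi : s i ⊆ ⋃ j, v j i) (hne : ∀ j n, n ≠ i → s n ⊆ v j n)
    (h : ∀ j, SeqMeasurablySeparable (v j)) : SeqMeasurablySeparable s := by
  choose t hsub hmeas hemp using h
  refine ⟨fun n => if n = i then ⋃ j, t j i else ⋂ j, t j n, fun n => ?_, fun n => ?_, ?_⟩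
  · by_cases hn : n = i
    · subst hn
      simp only [if_true]
      exact hi.trans (Set.iUnion_mono fun j => hsub j n)
    · simp only [if_neg hn]
      exact Set.subset_iInter fun j => (hne j n hn).trans (hsub j n)
  · by_cases hn : n = i
    · simp only [if_pos hn]
      exact MeasurableSet.iUnion fun j => hmeas j i
    · simp only [if_neg hn]
      exact MeasurableSet.iInter fun j => hmeas j n
  · rw [Set.eq_empty_iff_forall_notMem]
    intro x hx
    rw [Set.mem_iInter] at hx
    have h1 := hx i
    simp only [if_true, Set.mem_iUnion] at h1
    obtain ⟨j, hj⟩ := h1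
    have : x ∈ ⋂ n, t j n := by
      rw [Set.mem_iInter]
      intro n
      by_cases hn : n = i
      · rw [hn]; exact hj
      · have h2 := hx n
        simp only [if_neg hn, Set.mem_iInter] at h2
        exact h2 j
    rw [hemp] at this
    exact this

/-- Novikov's separation theorem for continuous images of the Baire space. -/
theorem seqMeasurablySeparable_range {α : Type*} [TopologicalSpace α] [T2Space α]
    [MeasurableSpace α] [OpensMeasurableSpace α] (f : ℕ → (ℕ → ℕ) → α)
    (hf : ∀ n, Continuous (f n)) (h : ⋂ n, Set.range (f n) = ∅) :
    SeqMeasurablySeparable fun n => Set.range (f n) := by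
  by_contra hsep
  -- a single sequence `x` codes a point of every domain: the `m`-th digit of the `n`-th one is
  -- `x (Nat.pair n m)`, and `V x k n` is the image of the set of points compatible with `x ↾ k`
  let V : (ℕ → ℕ) → ℕ → ℕ → Set α := fun x k n =>
    f n '' {y | ∀ m, Nat.pair n m < k → y m = x (Nat.pair n m)}
  have V_congr : ∀ x x' : ℕ → ℕ, ∀ k, (∀ i < k, x i = x' i) → V x k = V x' k := by
    intro x x' k hxx
    funext n
    have : {y : ℕ → ℕ | ∀ m, Nat.pair n m < k → y m = x (Nat.pair n m)} =
        {y | ∀ m, Nat.pair n m < k → y m = x' (Nat.pair n m)} := by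
      ext y
      exact forall_congr' fun m => forall_congr' fun hm => by rw [hxx _ hm]
    simp only [V, this]
  -- Fixing the `k`-th digit splits the set at position `(Nat.unpair k).1` into countably many
  -- pieces and leaves the other positions unchanged, so some value of the digit preserves
  -- inseparability.
  have step : ∀ x k, ¬ SeqMeasurablySeparable (V x k) →
      ∃ j, ¬ SeqMeasurablySeparable (V (Function.update x k j) (k + 1)) := by
    intro x k
    contrapose!
    intro H
    refine SeqMeasurablySeparable.of_iUnion (Nat.unpair k).1
      (v := fun j => V (Function.update x k j) (k + 1)) ?_ ?_ H
    · rintro _ ⟨y, hy, rfl⟩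
      refine Set.mem_iUnion.2 ⟨y (Nat.unpair k).2, y, fun m hm => ?_, rfl⟩
      rcases Nat.lt_succ_iff_lt_or_eq.1 hm with hlt | heq
      · rw [Function.update_of_ne hlt.ne]
        exact hy m hlt
      · rw [heq, Function.update_self, ← heq, Nat.unpair_pair]
    · rintro j n hn _ ⟨y, hy, rfl⟩
      refine ⟨y, fun m hm => ?_, rfl⟩
      rcases Nat.lt_succ_iff_lt_or_eq.1 hm with hlt | heq
      · rw [Function.update_of_ne hlt.ne]
        exact hy m hlt
      · exact absurd (by rw [← heq, Nat.unpair_pair]) hn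
  let A := {p : (ℕ → ℕ) × ℕ // ¬ SeqMeasurablySeparable (V p.1 p.2)}
  have stepA : ∀ p : A, ∃ q : A, q.1.2 = p.1.2 + 1 ∧ ∀ i < p.1.2, q.1.1 i = p.1.1 i := by
    rintro ⟨⟨x, k⟩, hp⟩
    obtain ⟨j, hj⟩ := step x k hp
    exact ⟨⟨⟨Function.update x k j, k + 1⟩, hj⟩, rfl,
      fun i hi => Function.update_of_ne (ne_of_lt hi) _ _⟩
  choose F hF1 hF2 using stepA
  let p0 : A := ⟨⟨fun _ => 0, 0⟩, by simpa [V, Set.image_univ] using hsep⟩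
  let p : ℕ → A := fun n => F^[n] p0
  have prec : ∀ n, p (n + 1) = F (p n) := fun n => by
    simp only [p, Function.iterate_succ', Function.comp]
  have plen : ∀ n, (p n).1.2 = n := by
    intro n
    induction n with
    | zero => rfl
    | succ n ih => rw [prec, hF1, ih]
  have pstable : ∀ n k i, i < n → (p (n + k)).1.1 i = (p n).1.1 i := by
    intro n k i hi
    induction k with
    | zero => rfl
    | succ k ih =>
      rw [← add_assoc, prec, hF2, ih]
      rw [plen]; omega
  let x : ℕ → ℕ := fun i => (p (i + 1)).1.1 i
  have hx : ∀ k, ¬ SeqMeasurablySeparable (V x k) := by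
    intro k
    have h1 : V x k = V (p k).1.1 k := by
      refine V_congr _ _ _ fun i hi => ?_
      obtain ⟨l, rfl⟩ := Nat.exists_eq_add_of_lt hi
      have := pstable (i + 1) l i (Nat.lt_succ_self i)
      rw [show i + l + 1 = i + 1 + l by ring]
      exact this.symm
    rw [h1]
    have := (p k).2
    rwa [plen] at this
  let z : ℕ → (ℕ → ℕ) := fun n m => x (Nat.pair n m)
  -- The digits chosen in the limit determine one point in each range. These points cannot all
  -- coincide, and by continuity disjoint neighbourhoods of two of them separate `V x k` for large
  -- `k`.
  obtain ⟨i, hi⟩ : ∃ i, f i (z i) ≠ f 0 (z 0) := by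
    by_contra! hcon
    have : f 0 (z 0) ∈ ⋂ n, Set.range (f n) := Set.mem_iInter.2 fun n => ⟨z n, hcon n⟩
    rw [h] at this
    exact this
  have hi0 : i ≠ 0 := by rintro rfl; exact hi rfl
  obtain ⟨O, O', hO, hO', hzO, hzO', hdisj⟩ := t2_separation hi
  have small : ∀ (n : ℕ) (W : Set α), IsOpen W → f n (z n) ∈ W →
      ∃ k, ∀ k' ≥ k, V x k' n ⊆ W := by
    intro n W hW hz
    have h1 : IsOpen (f n ⁻¹' W) := hW.preimage (hf n)
    obtain ⟨u, ⟨w, l, rfl⟩, hzu, hu⟩ :=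
      (PiNat.isTopologicalBasis_cylinders (fun _ : ℕ => ℕ)).exists_subset_of_mem_open
        (show z n ∈ f n ⁻¹' W from hz) h1
    refine ⟨Nat.pair n l, fun k' hk' => ?_⟩
    rintro _ ⟨y, hy, rfl⟩
    refine hu ?_
    rw [PiNat.mem_cylinder_iff] at hzu ⊢
    intro a ha
    rw [hy a (lt_of_lt_of_le (Nat.pair_lt_pair_right n ha) hk')]
    exact hzu a ha
  obtain ⟨k, hk⟩ := small i O hO hzO
  obtain ⟨k', hk'⟩ := small 0 O' hO' hzO'
  refine hx (max k k') ⟨fun n => if n = i then O else if n = 0 then O' else Set.univ,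
    fun n => ?_, fun n => ?_, ?_⟩
  · dsimp only
    split_ifs with h1 h2
    · rw [h1]; exact hk _ (le_max_left _ _)
    · rw [h2]; exact hk' _ (le_max_right _ _)
    · exact Set.subset_univ _
  · dsimp only
    split_ifs
    exacts [hO.measurableSet, hO'.measurableSet, MeasurableSet.univ]
  · rw [Set.eq_empty_iff_forall_notMem]
    intro a ha
    rw [Set.mem_iInter] at ha
    have h1 := ha i
    have h2 := ha 0
    simp only [if_true, if_neg hi0.symm] at h1 h2
    exact Set.disjoint_left.1 hdisj h1 h2

/-- Novikov's separation theorem. -/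
theorem AnalyticSet.seqMeasurablySeparable {α : Type*} [TopologicalSpace α] [T2Space α]
    [MeasurableSpace α] [OpensMeasurableSpace α] {s : ℕ → Set α} (hs : ∀ n, AnalyticSet (s n))
    (h : ⋂ n, s n = ∅) : SeqMeasurablySeparable s := by
  by_cases hemp : ∃ n, s n = ∅
  · obtain ⟨n, hn⟩ := hemp
    refine ⟨fun m => if m = n then ∅ else Set.univ, fun m => ?_, fun m => ?_, ?_⟩
    · dsimp only
      split_ifs with hm
      · rw [hm, hn]
      · exact Set.subset_univ _
    · dsimp only
      split_ifs
      exacts [MeasurableSet.empty, MeasurableSet.univ]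
    · refine Set.eq_empty_of_subset_empty ?_
      exact (Set.iInter_subset _ n).trans (by simp)
  · push Not at hemp
    have : ∀ n, ∃ f : (ℕ → ℕ) → α, Continuous f ∧ Set.range f = s n := by
      intro n
      rcases (analyticSet_iff_exists_polishSpace_range.1 (hs n)) with ⟨β, _, _, f, hf, hr⟩
      have hne : Nonempty β := by
        rw [← Set.range_nonempty_iff_nonempty (f := f), hr]
        exact hemp n
      obtain ⟨g, hg, hgs⟩ := PolishSpace.exists_nat_nat_continuous_surjective β
      exact ⟨f ∘ g, hf.comp hg, by rw [hgs.range_comp, hr]⟩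
    choose f hf hr using this
    have := seqMeasurablySeparable_range f hf (by simpa [hr] using h)
    simpa [hr] using this

/-- A Borel set with finite sections has a Borel projection. -/
theorem measurableSet_exists_of_finite {Y X : Type*} [MeasurableSpace Y] [StandardBorelSpace Y]
    [MeasurableSpace X] [StandardBorelSpace X] {A : Y → X → Prop}
    (hA : MeasurableSet {p : Y × X | A p.1 p.2}) (hfin : ∀ y, {x | A y x}.Finite) :
    MeasurableSet {y | ∃ x, A y x} := by
  let := upgradeStandardBorel X
  let := upgradeStandardBorel Y
  obtain ⟨V, hVne, hV⟩ : ∃ V : ℕ → Set X, (∀ n, IsOpen (V n)) ∧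
      ∀ (x : X) (W : Set X), IsOpen W → x ∈ W → ∃ n, x ∈ V n ∧ V n ⊆ W := by
    obtain ⟨b, hbc, -, hb⟩ := TopologicalSpace.exists_countable_basis X
    rcases b.eq_empty_or_nonempty with rfl | hne
    · refine ⟨fun _ => ∅, fun _ => isOpen_empty, fun x W hW hx => ?_⟩
      obtain ⟨u, hu, -⟩ := hb.exists_subset_of_mem_open hx hW
      exact absurd hu (Set.notMem_empty _)
    · obtain ⟨V, rfl⟩ := hbc.exists_eq_range hne
      refine ⟨V, fun n => hb.isOpen ⟨n, rfl⟩, fun x W hW hx => ?_⟩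
      obtain ⟨_, ⟨n, rfl⟩, h1, h2⟩ := hb.exists_subset_of_mem_open hx hW
      exact ⟨n, h1, h2⟩
  -- `Z n` consists of the points of `A` not isolated in their section by `V n`
  let Q : ℕ → Set ((Y × X) × X × X) := fun n =>
    {p | A p.1.1 p.1.2 ∧ A p.1.1 p.2.1 ∧ A p.1.1 p.2.2 ∧
      (p.1.2 ∉ V n ∨ (p.2.1 ∈ V n ∧ p.2.2 ∈ V n ∧ p.2.1 ≠ p.2.2))}
  have hQ : ∀ n, MeasurableSet (Q n) := by
    intro n
    have hVm : MeasurableSet (V n) := (hVne n).measurableSet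
    have h1 : MeasurableSet {p : (Y × X) × X × X | A p.1.1 p.1.2} := measurable_fst hA
    have h2 : MeasurableSet {p : (Y × X) × X × X | A p.1.1 p.2.1} :=
      (show Measurable (fun p : (Y × X) × X × X => (p.1.1, p.2.1)) by fun_prop) hA
    have h3 : MeasurableSet {p : (Y × X) × X × X | A p.1.1 p.2.2} :=
      (show Measurable (fun p : (Y × X) × X × X => (p.1.1, p.2.2)) by fun_prop) hA
    have h4 : MeasurableSet {p : (Y × X) × X × X | p.1.2 ∉ V n} :=
      (show Measurable (fun p : (Y × X) × X × X => p.1.2) by fun_prop) hVm.compl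
    have h5 : MeasurableSet {p : (Y × X) × X × X | p.2.1 ∈ V n} :=
      (show Measurable (fun p : (Y × X) × X × X => p.2.1) by fun_prop) hVm
    have h6 : MeasurableSet {p : (Y × X) × X × X | p.2.2 ∈ V n} :=
      (show Measurable (fun p : (Y × X) × X × X => p.2.2) by fun_prop) hVm
    have h7 : MeasurableSet {p : (Y × X) × X × X | p.2.1 ≠ p.2.2} :=
      (measurableSet_eq_fun (by fun_prop) (by fun_prop)).compl
    exact h1.inter (h2.inter (h3.inter (h4.union (h5.inter (h6.inter h7)))))
  have hZ : ∀ n, AnalyticSet (Prod.fst '' Q n) := fun n =>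
    (hQ n).analyticSet_image measurable_fst
  have hemp : ⋂ n, Prod.fst '' Q n = ∅ := by
    rw [Set.eq_empty_iff_forall_notMem]
    rintro ⟨y, x⟩ hyx
    rw [Set.mem_iInter] at hyx
    have hAyx : A y x := by
      obtain ⟨⟨⟨y', x'⟩, w⟩, hp, hp'⟩ := hyx 0
      obtain ⟨rfl, rfl⟩ := Prod.mk.inj hp'
      exact hp.1
    -- The section is finite, so the rest of it is closed and some `V n` isolates `x` in it.
    have hcl : IsOpen ({x' | A y x'} \ {x})ᶜ :=
      (((hfin y).subset Set.sdiff_subset).isClosed).isOpen_compl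
    obtain ⟨n, hxn, hn⟩ := hV x _ hcl (fun h => h.2 rfl)
    obtain ⟨⟨⟨y', x'⟩, x1, x2⟩, ⟨-, h1, h2, h3⟩, hp'⟩ := hyx n
    obtain ⟨rfl, rfl⟩ := Prod.mk.inj hp'
    rcases h3 with h3 | ⟨h3, h4, h5⟩
    · exact h3 hxn
    · have e1 : x1 = x' := by
        by_contra hne
        exact hn h3 ⟨h1, hne⟩
      have e2 : x2 = x' := by
        by_contra hne
        exact hn h4 ⟨h2, hne⟩
      exact h5 (e1.trans e2.symm)
  -- The sets of non-isolated points are only analytic; Novikov encloses them in Borel sets `t n`,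
  -- still with empty intersection. Off `t n` the projection is injective on `A`, so its image there
  -- is Borel, and these images exhaust the projection.
  obtain ⟨t, ht, htm, hte⟩ := AnalyticSet.seqMeasurablySeparable hZ hemp
  have hunion : {y | ∃ x, A y x} = ⋃ n, Prod.fst '' ({p : Y × X | A p.1 p.2} \ t n) := by
    ext y
    simp only [Set.mem_ofPred_eq, Set.mem_iUnion, Set.mem_image]
    constructor
    · rintro ⟨x, hx⟩
      have : (y, x) ∉ ⋂ n, t n := by rw [hte]; exact Set.notMem_empty _
      rw [Set.mem_iInter, not_forall] at this
      obtain ⟨n, hn⟩ := this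
      exact ⟨n, (y, x), ⟨hx, hn⟩, rfl⟩
    · rintro ⟨n, ⟨y', x⟩, ⟨h1, -⟩, rfl⟩
      exact ⟨x, h1⟩
  rw [hunion]
  refine MeasurableSet.iUnion fun n => ?_
  refine (hA.diff (htm n)).image_of_measurable_injOn measurable_fst ?_
  rintro ⟨y, x⟩ ⟨h1, h1'⟩ ⟨y', x'⟩ ⟨h2, h2'⟩ (rfl : y = y')
  by_contra hne
  have hxx : x ≠ x' := fun h => hne (by rw [h])
  have hxV : x ∈ V n := by
    by_contra hcon
    exact h1' (ht n ⟨((y, x), x, x), ⟨h1, h1, h1, Or.inl hcon⟩, rfl⟩)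
  have hxV' : x' ∈ V n := by
    by_contra hcon
    exact h2' (ht n ⟨((y, x'), x, x), ⟨h2, h1, h1, Or.inl hcon⟩, rfl⟩)
  exact h1' (ht n ⟨((y, x), x, x'), ⟨h1, h1, h2, Or.inr ⟨hxV, hxV', hxx⟩⟩, rfl⟩)

/-- In a standard Borel space a sequence of Borel sets separates any two disjoint finite sets. -/
theorem exists_seq_measurableSet_separating (X : Type*) [MeasurableSpace X]
    [StandardBorelSpace X] : ∃ U : ℕ → Set X, (∀ n, MeasurableSet (U n)) ∧
      ∀ S F : Set X, S.Finite → F.Finite → Disjoint S F → ∃ n, S ⊆ U n ∧ Disjoint F (U n) := by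
  let := upgradeStandardBorel X
  obtain ⟨b, hbc, -, hb⟩ := TopologicalSpace.exists_countable_basis X
  -- The sequence enumerates the finite unions of basic open sets; finitely many of them cover `S`
  -- inside the open set `Fᶜ`.
  have hcount : {s : Set (Set X) | s.Finite ∧ s ⊆ b}.Countable :=
    Set.countable_ofPred_finite_subset hbc
  obtain ⟨W, hW⟩ := hcount.exists_eq_range ⟨∅, Set.finite_empty, Set.empty_subset _⟩
  have hWn : ∀ n, (W n).Finite ∧ W n ⊆ b := fun n => by
    have : W n ∈ {s : Set (Set X) | s.Finite ∧ s ⊆ b} := hW ▸ ⟨n, rfl⟩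
    exact this
  refine ⟨fun n => ⋃₀ W n, fun n => MeasurableSet.sUnion (hWn n).1.countable fun u hu =>
    (hb.isOpen ((hWn n).2 hu)).measurableSet, fun S F hS hF hSF => ?_⟩
  have : ∀ x : S, ∃ u ∈ b, x.1 ∈ u ∧ u ⊆ Fᶜ := fun x =>
    hb.exists_subset_of_mem_open (Set.disjoint_left.1 hSF x.2) hF.isClosed.isOpen_compl
  choose u hub hxu huF using this
  have : Finite S := hS
  have hmem : Set.range u ∈ {s : Set (Set X) | s.Finite ∧ s ⊆ b} :=
    ⟨Set.finite_range u, by rintro _ ⟨x, rfl⟩; exact hub x⟩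
  rw [hW] at hmem
  obtain ⟨n, hn⟩ := hmem
  refine ⟨n, fun x hx => ?_, ?_⟩
  · change x ∈ ⋃₀ W n
    rw [hn]
    exact ⟨u ⟨x, hx⟩, ⟨_, rfl⟩, hxu ⟨x, hx⟩⟩
  · change Disjoint F (⋃₀ W n)
    rw [hn, Set.disjoint_right]
    rintro x ⟨_, ⟨y, rfl⟩, hy⟩
    exact huF y hy

/-- In a standard Borel space a sequence of Borel `q`-colorings realizes every coloring of every
finite set. -/
theorem exists_seq_measurable_dense (X : Type*) [MeasurableSpace X] [StandardBorelSpace X] {q : ℕ}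
    (hq : 0 < q) : ∃ h : ℕ → X → Fin q, (∀ n, Measurable (h n)) ∧
      ∀ (S : Set X) (g : X → Fin q), S.Finite → ∃ n, ∀ x ∈ S, h n x = g x := by
  classical
  obtain ⟨U, hU, hsep⟩ := exists_seq_measurableSet_separating X
  have : Nonempty (Fin q → ℕ) := ⟨fun _ => 0⟩
  obtain ⟨e, he⟩ := exists_surjective_nat (Fin q → ℕ)
  -- A tuple of indices codes a colouring: `x` gets colour `i` if `U (a i)` is the only one of the
  -- chosen sets containing it, and colour 0 by default. To realize `g` on `S`, separate each colour
  -- class from the rest of `S`.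
  let c : (Fin q → ℕ) → X → Fin q := fun a x =>
    if hx : ∃ i, x ∈ U (a i) ∧ ∀ j, x ∈ U (a j) → j = i then hx.choose else ⟨0, hq⟩
  have hc : ∀ a x i, x ∈ U (a i) → (∀ j, x ∈ U (a j) → j = i) → c a x = i := by
    intro a x i h1 h2
    have hx : ∃ i, x ∈ U (a i) ∧ ∀ j, x ∈ U (a j) → j = i := ⟨i, h1, h2⟩
    simp only [c, dif_pos hx]
    exact h2 _ hx.choose_spec.1
  refine ⟨fun n => c (e n), fun n => ?_, fun S g hS => ?_⟩
  · refine measurable_to_countable' fun i => ?_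
    set a := e n
    let P : Fin q → Set X := fun i => {x | x ∈ U (a i) ∧ ∀ j, x ∈ U (a j) → j = i}
    have hP : ∀ i, MeasurableSet (P i) := by
      intro i
      have : P i = U (a i) ∩ ⋂ j, {x | x ∈ U (a j) → j = i} := by
        ext x; simp [P]
      rw [this]
      refine (hU _).inter (MeasurableSet.iInter fun j => ?_)
      by_cases hj : j = i
      · simp [hj]
      · have : {x | x ∈ U (a j) → j = i} = (U (a j))ᶜ := by ext x; simp [hj]
        rw [this]
        exact (hU (a j)).compl
    have hset : c a ⁻¹' {i} = P i ∪ ((⋃ j, P j)ᶜ ∩ {_x | i = ⟨0, hq⟩}) := by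
      ext x
      simp only [Set.mem_preimage, Set.mem_singleton_iff, Set.mem_union, Set.mem_inter_iff,
        Set.mem_compl_iff, Set.mem_iUnion, Set.mem_ofPred_eq]
      by_cases hx : ∃ i, x ∈ P i
      · obtain ⟨i', hi'⟩ := hx
        rw [hc a x i' hi'.1 hi'.2]
        constructor
        · rintro rfl; exact Or.inl hi'
        · rintro (h | h)
          · exact h.2 _ hi'.1
          · exact absurd ⟨i', hi'⟩ h.1
      · have : c a x = ⟨0, hq⟩ := dif_neg hx
        rw [this]
        constructor
        · exact fun h => Or.inr ⟨hx, h.symm⟩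
        · rintro (h | h)
          · exact absurd ⟨i, h⟩ hx
          · exact h.2.symm
    rw [hset]
    exact (hP i).union ((MeasurableSet.iUnion hP).compl.inter (MeasurableSet.const _))
  · have : ∀ i : Fin q, ∃ n, {x ∈ S | g x = i} ⊆ U n ∧ Disjoint {x ∈ S | g x ≠ i} (U n) :=
      fun i => hsep _ _ (hS.subset (Set.sep_subset _ _)) (hS.subset (Set.sep_subset _ _))
        (Set.disjoint_left.2 fun x h1 h2 => h2.2 h1.2)
    choose a ha hd using this
    obtain ⟨n, hn⟩ := he a
    refine ⟨n, fun x hx => ?_⟩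
    change c (e n) x = g x
    rw [hn]
    refine hc a x _ (ha _ ⟨hx, rfl⟩) fun j hj => ?_
    by_contra hne
    exact Set.disjoint_left.1 (hd j) ⟨hx, fun h => hne h.symm⟩ hj

end MeasureTheory

/-! ### The finite Lovász Local Lemma by counting. -/

namespace LocalLemma

open Finset

variable {Ω I : Type*} [Fintype Ω] [DecidableEq Ω]

/-- The set of outcomes avoiding all the events indexed by `J`. -/
def avoid (A : I → Finset Ω) (J : Finset I) : Finset Ω := univ.filter fun ω => ∀ j ∈ J, ω ∉ A j

theorem mem_avoid {A : I → Finset Ω} {J : Finset I} {ω : Ω} :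
    ω ∈ avoid A J ↔ ∀ j ∈ J, ω ∉ A j := by simp [avoid]

theorem card_avoid_insert [DecidableEq I] (A : I → Finset Ω) (J : Finset I) (i : I) :
    (avoid A (insert i J)).card + (A i ∩ avoid A J).card = (avoid A J).card := by
  have h : avoid A (insert i J) = avoid A J \ (A i ∩ avoid A J) := by
    ext ω
    simp only [mem_sdiff, mem_inter, mem_avoid, mem_insert, forall_eq_or_imp]
    tauto
  rw [h, card_sdiff_of_subset inter_subset_right]
  exact Nat.sub_add_cancel (card_le_card inter_subset_right)

/-- The symmetric Lovász Local Lemma for the uniform distribution on a finite set: each event has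
probability at most `1 / (e (d + 1))` and is independent of the avoidance of any family of events
outside a set of at most `d` neighbors. -/
theorem exists_avoiding [DecidableEq I] [Nonempty Ω] (K : Finset I) (A : I → Finset Ω) (N : I → Finset I) (d : ℕ)
    (hN : ∀ i ∈ K, (N i).card ≤ d)
    (hind : ∀ i ∈ K, ∀ J ⊆ K, i ∉ J → Disjoint J (N i) →
      (A i ∩ avoid A J).card * Fintype.card Ω = (A i).card * (avoid A J).card)
    (hp : ∀ i ∈ K, ((A i).card : ℝ) * (Real.exp 1 * (d + 1)) ≤ Fintype.card Ω) :
    ∃ ω, ∀ i ∈ K, ω ∉ A i := by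
  have hΩ : (0 : ℝ) < Fintype.card Ω := by exact_mod_cast Fintype.card_pos
  -- `r` bounds from below the conditional probability of avoiding one further event; up to `d`
  -- neighbours cost `r ^ d`, which is at least 1/e because (1 + 1/d)^d ≤ e.
  set r : ℝ := 1 - 1 / (d + 1 : ℝ) with hr
  have hr0 : 0 ≤ r := by
    rw [hr, sub_nonneg, div_le_one (by positivity)]
    linarith [Nat.cast_nonneg (α := ℝ) d]
  have hr1 : r ≤ 1 := by
    rw [hr]; linarith [show (0 : ℝ) ≤ 1 / (d + 1 : ℝ) by positivity]
  have hrd : 1 ≤ Real.exp 1 * r ^ d := by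
    rcases Nat.eq_zero_or_pos d with rfl | hd
    · simp
    · have hd' : (0 : ℝ) < d := by exact_mod_cast hd
      have h1 : r = (1 + 1 / (d : ℝ))⁻¹ := by
        rw [hr]; field_simp; ring
      have h2 : 1 + 1 / (d : ℝ) ≤ Real.exp (1 / d) := by
        rw [add_comm]; exact Real.add_one_le_exp _
      have h3 : (1 + 1 / (d : ℝ)) ^ d ≤ Real.exp 1 := by
        calc (1 + 1 / (d : ℝ)) ^ d ≤ Real.exp (1 / d) ^ d :=
              pow_le_pow_left₀ (by positivity) h2 d
          _ = Real.exp 1 := by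
              rw [← Real.exp_nat_mul]; congr 1; field_simp
      rw [h1, inv_pow, ← div_eq_mul_inv, one_le_div (by positivity)]
      exact h3
  -- The inductive claim: conditioned on avoiding `J`, the event `A i` has probability at most
  -- 1/(d+1).
  have key : ∀ n : ℕ, ∀ J ⊆ K, J.card ≤ n → ∀ i ∈ K, i ∉ J →
      ((A i ∩ avoid A J).card : ℝ) * (d + 1) ≤ (avoid A J).card := by
    intro n
    induction n with
    | zero =>
      intro J hJ hJn i hi hiJ
      have hJ0 : J = ∅ := by simpa using hJn
      subst hJ0
      have h1 : avoid A ∅ = univ := by ext; simp [mem_avoid]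
      rw [h1, inter_univ, card_univ]
      refine le_trans ?_ (hp i hi)
      refine mul_le_mul_of_nonneg_left ?_ (by positivity)
      have : 1 ≤ Real.exp 1 := Real.one_le_exp (by norm_num)
      nlinarith [Nat.cast_nonneg (α := ℝ) d]
    | succ n ih =>
      intro J hJ hJn i hi hiJ
      -- Non-neighbours enter through independence; the neighbours in `J` are then added one at a
      -- time, each step applying the induction hypothesis to a smaller family.
      set J2 := J.filter (· ∉ N i) with hJ2
      have hJ2J : J2 ⊆ J := filter_subset _ _
      have hchain : ∀ T ⊆ J.filter (· ∈ N i),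
          ((avoid A J2).card : ℝ) * r ^ T.card ≤ (avoid A (J2 ∪ T)).card := by
        intro T
        induction T using Finset.induction_on with
        | empty => intro _; simp
        | insert a T haT ihT =>
          intro hT
          have hT' : T ⊆ J.filter (· ∈ N i) := (subset_insert _ _).trans hT
          have haJ : a ∈ J.filter (· ∈ N i) := hT (mem_insert_self _ _)
          rw [mem_filter] at haJ
          have hJT : J2 ∪ T ⊆ J := union_subset hJ2J (hT'.trans (filter_subset _ _))
          have ha : a ∉ J2 ∪ T := by
            rw [mem_union, not_or]
            refine ⟨fun h => ?_, haT⟩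
            exact (mem_filter.1 h).2 haJ.2
          have hcard : (J2 ∪ T).card ≤ n := by
            have : (J2 ∪ T).card < J.card :=
              card_lt_card ⟨hJT, fun h => ha (h haJ.1)⟩
            omega
          have h1 := ih (J2 ∪ T) (hJT.trans hJ) hcard a (hJ haJ.1) ha
          have h2 := card_avoid_insert A (J2 ∪ T) a
          have h2' : ((avoid A (insert a (J2 ∪ T))).card : ℝ) + (A a ∩ avoid A (J2 ∪ T)).card =
              (avoid A (J2 ∪ T)).card := by exact_mod_cast h2
          rw [card_insert_of_notMem haT, union_insert, pow_succ, ← mul_assoc]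
          have h3 : ((avoid A (J2 ∪ T)).card : ℝ) * r ≤ (avoid A (insert a (J2 ∪ T))).card := by
            have h4 : ((A a ∩ avoid A (J2 ∪ T)).card : ℝ) ≤
                (avoid A (J2 ∪ T)).card / (d + 1) := by
              rw [le_div_iff₀ (by positivity)]; exact h1
            rw [hr, mul_sub, mul_one, mul_one_div]
            linarith
          exact (mul_le_mul_of_nonneg_right (ihT hT') hr0).trans h3
      have hJu : J2 ∪ J.filter (· ∈ N i) = J := by
        rw [hJ2, union_comm]; exact filter_union_filter_not_eq _ _
      have h1 := hchain _ (Subset.refl _)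
      rw [hJu] at h1
      have hcardN : (J.filter (· ∈ N i)).card ≤ d :=
        (card_le_card fun x hx => (mem_filter.1 hx).2).trans (hN i hi)
      have h2 : ((avoid A J2).card : ℝ) * r ^ d ≤ (avoid A J).card :=
        (mul_le_mul_of_nonneg_left (pow_le_pow_of_le_one hr0 hr1 hcardN)
          (by positivity)).trans h1
      have h3 : ((A i ∩ avoid A J2).card : ℝ) * Fintype.card Ω = (A i).card * (avoid A J2).card := by
        exact_mod_cast hind i hi J2 (hJ2J.trans hJ) (fun h => hiJ (hJ2J h))
          (disjoint_left.2 fun x hx => (mem_filter.1 hx).2)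
      have h4 : ((A i ∩ avoid A J).card : ℝ) ≤ (A i ∩ avoid A J2).card := by
        exact_mod_cast card_le_card (inter_subset_inter_left fun ω hω =>
          mem_avoid.2 fun j hj => mem_avoid.1 hω j (hJ2J hj))
      have h5 : ((A i ∩ avoid A J2).card : ℝ) * (Real.exp 1 * (d + 1)) ≤ (avoid A J2).card := by
        have h6 := mul_le_mul_of_nonneg_right (hp i hi)
          (Nat.cast_nonneg (α := ℝ) (avoid A J2).card)
        refine le_of_mul_le_mul_right ?_ hΩ
        calc _ = ((A i ∩ avoid A J2).card : ℝ) * Fintype.card Ω * (Real.exp 1 * (d + 1)) := by ring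
          _ = (A i).card * (Real.exp 1 * (d + 1)) * (avoid A J2).card := by rw [h3]; ring
          _ ≤ _ := by rw [mul_comm ((avoid A J2).card : ℝ)]; exact h6
      calc ((A i ∩ avoid A J).card : ℝ) * (d + 1)
          ≤ (A i ∩ avoid A J2).card * (d + 1) := by gcongr
        _ ≤ (A i ∩ avoid A J2).card * (d + 1) * (Real.exp 1 * r ^ d) :=
            le_mul_of_one_le_right (by positivity) hrd
        _ = (A i ∩ avoid A J2).card * (Real.exp 1 * (d + 1)) * r ^ d := by ring
        _ ≤ (avoid A J2).card * r ^ d := by gcongr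
        _ ≤ _ := h2
  have main : ∀ J ⊆ K, 0 < (avoid A J).card := by
    intro J
    induction J using Finset.induction_on with
    | empty =>
      intro _
      have h1 : avoid A ∅ = univ := by ext; simp [mem_avoid]
      rw [h1, card_univ]
      exact Fintype.card_pos
    | insert a T haT ih =>
      intro hT
      have hT' : T ⊆ K := (subset_insert _ _).trans hT
      have haK : a ∈ K := hT (mem_insert_self _ _)
      have h0 := ih hT'
      have hbound : ((A a ∩ avoid A T).card : ℝ) < (avoid A T).card := by
        rcases Nat.eq_zero_or_pos d with hd | hd
        · -- without neighbors the event is independent of the rest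
          have hN0 : N a = ∅ := by
            have := hN a haK
            rw [hd] at this
            simpa using this
          have h3 : ((A a ∩ avoid A T).card : ℝ) * Fintype.card Ω =
              (A a).card * (avoid A T).card := by
            exact_mod_cast hind a haK T hT' haT (by rw [hN0]; exact disjoint_empty_right _)
          have h4 := hp a haK
          rw [hd] at h4
          have h5 : (1 : ℝ) < Real.exp 1 := Real.one_lt_exp_iff.2 one_pos
          have h6 : ((A a).card : ℝ) < Fintype.card Ω := by
            rcases (Nat.cast_nonneg (α := ℝ) (A a).card).eq_or_lt with h | h
            · rw [← h]; exact hΩ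
            · norm_num at h4
              nlinarith
          have h0' : (0 : ℝ) < (avoid A T).card := by exact_mod_cast h0
          refine lt_of_mul_lt_mul_right ?_ hΩ.le
          rw [h3, mul_comm ((avoid A T).card : ℝ)]
          exact mul_lt_mul_of_pos_right h6 h0'
        · have h3 := key _ T hT' le_rfl a haK haT
          have h0' : (0 : ℝ) < (avoid A T).card := by exact_mod_cast h0
          have hd' : (1 : ℝ) ≤ d := by exact_mod_cast hd
          rcases (Nat.cast_nonneg (α := ℝ) (A a ∩ avoid A T).card).eq_or_lt with h | h
          · rw [← h]; exact h0'
          · nlinarith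
      have h2 := card_avoid_insert A T a
      have h3 : (A a ∩ avoid A T).card < (avoid A T).card := by exact_mod_cast hbound
      omega
  obtain ⟨ω, hω⟩ := card_pos.1 (main K (Subset.refl _))
  exact ⟨ω, mem_avoid.1 hω⟩

/-- Events depending on disjoint sets of coordinates are independent. -/
theorem card_inter_mul_card {ι κ : Type*} [Fintype ι] [DecidableEq ι] [Fintype κ] [DecidableEq κ]
    (D : Set ι) (A C : Finset (ι → κ))
    (hA : ∀ ω ω' : ι → κ, (∀ i ∈ D, ω i = ω' i) → (ω ∈ A ↔ ω' ∈ A))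
    (hC : ∀ ω ω' : ι → κ, (∀ i ∉ D, ω i = ω' i) → (ω ∈ C ↔ ω' ∈ C)) :
    (A ∩ C).card * Fintype.card (ι → κ) = A.card * C.card := by
  classical
  rw [← card_univ, ← card_product, ← card_product]
  -- Exchanging the coordinates outside `D` between two outcomes is an involution carrying (A ∩ C) ×
  -- Ω onto A × C.
  let sw : (ι → κ) × (ι → κ) → (ι → κ) × (ι → κ) := fun p =>
    (fun i => if i ∈ D then p.1 i else p.2 i, fun i => if i ∈ D then p.2 i else p.1 i)
  have hsw : ∀ p, sw (sw p) = p := by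
    rintro ⟨a, b⟩
    simp only [sw, Prod.mk.injEq]
    constructor <;> funext i <;> by_cases hi : i ∈ D <;> simp [hi]
  refine card_bij' (fun p _ => sw p) (fun p _ => sw p) ?_ ?_ (fun p _ => hsw p) (fun p _ => hsw p)
  · rintro ⟨a, b⟩ hab
    simp only [mem_product, mem_inter, mem_univ, and_true] at hab ⊢
    refine ⟨(hA _ a fun i hi => ?_).2 hab.1, (hC _ a fun i hi => ?_).2 hab.2⟩ <;> simp [sw, hi]
  · rintro ⟨a, b⟩ hab
    simp only [mem_product, mem_inter, mem_univ, and_true] at hab ⊢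
    refine ⟨(hA _ a fun i hi => ?_).2 hab.1, (hC _ b fun i hi => ?_).2 hab.2⟩ <;> simp [sw, hi]

end LocalLemma

/-! ### Borel structure on finite sets, partial functions and constraints. -/

section FinsetBorel

variable {X Y Z : Type*} [MeasurableSpace X] [MeasurableSpace Y] [MeasurableSpace Z]

theorem measurable_finset_map {T : Type*} (S : Finset T) (f : Z → T → Y)
    (hf : ∀ t, Measurable fun z => f z t) (hinj : ∀ z, Function.Injective (f z)) :
    Measurable[_, finsetBorel Y] fun z => S.map ⟨f z, hinj z⟩ := by
  intro A hA
  rw [measurableSet_finsetBorel_iff] at hA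
  let e := S.equivFin
  have hinj' : ∀ z, Function.Injective fun i => f z (e.symm i) := fun z =>
    (hinj z).comp (Subtype.val_injective.comp e.symm.injective)
  have hmeas : Measurable fun z =>
      (⟨fun i => f z (e.symm i), hinj' z⟩ : {x : Fin S.card → Y // Function.Injective x}) :=
    (measurable_pi_lambda _ fun i => hf _).subtype_mk
  have := hmeas (hA S.card)
  convert! this using 1
  ext z
  have : S.map ⟨f z, hinj z⟩ =
      (Finset.univ : Finset (Fin S.card)).map ⟨fun i => f z (e.symm i), hinj' z⟩ := by
    ext y
    simp only [Finset.mem_map, Function.Embedding.coeFn_mk, Finset.mem_univ, true_and]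
    constructor
    · rintro ⟨t, ht, rfl⟩
      exact ⟨e ⟨t, ht⟩, by simp⟩
    · rintro ⟨i, rfl⟩
      exact ⟨_, (e.symm i).2, rfl⟩
  simp [this]

-- Membership in a domain, agreement with a colouring and conditional probabilities are all read off
-- from such counts.
open Classical in
theorem measurable_card_filter {V : Set Y} (hV : MeasurableSet V) :
    Measurable[finsetBorel Y, _] fun S : Finset Y => (S.filter (· ∈ V)).card := by
  refine @measurable_to_countable' ℕ (Finset Y) _ _ (finsetBorel Y) _ fun m => ?_
  rw [measurableSet_finsetBorel_iff]
  intro k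
  have : Measurable fun x : {x : Fin k → Y // Function.Injective x} =>
      ∑ i, if x.1 i ∈ V then 1 else 0 := by
    refine Finset.measurable_sum _ fun i _ => ?_
    refine Measurable.ite ?_ measurable_const measurable_const
    exact ((measurable_pi_apply i).comp measurable_subtype_coe) hV
  have h2 := this (measurableSet_singleton m)
  convert! h2 using 1
  ext x
  simp only [Set.mem_ofPred_eq, Set.mem_preimage, Set.mem_singleton_iff, Finset.filter_map,
    Finset.card_map]
  rw [Finset.card_filter]
  rfl

theorem measurableSet_injective (X : Type*) [MeasurableSpace X] [StandardBorelSpace X] (k : ℕ) :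
    MeasurableSet {x : Fin k → X | Function.Injective x} := by
  have : {x : Fin k → X | Function.Injective x} =
      ⋂ i, ⋂ j, {x | x i = x j → i = j} := by
    ext x; simp [Function.Injective]
  rw [this]
  refine MeasurableSet.iInter fun i => MeasurableSet.iInter fun j => ?_
  by_cases hij : i = j
  · simp [hij]
  · have : {x : Fin k → X | x i = x j → i = j} = {x | x i = x j}ᶜ := by ext x; simp [hij]
    rw [this]
    exact (measurableSet_eq_fun (measurable_pi_apply i) (measurable_pi_apply j)).compl

instance standardBorelSpace_injective (X : Type*) [MeasurableSpace X] [StandardBorelSpace X]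
    (k : ℕ) : StandardBorelSpace {x : Fin k → X // Function.Injective x} :=
  (measurableSet_injective X k).standardBorel

end FinsetBorel

namespace FinPartialFun

variable {X : Type*} {q : ℕ}

/-- The finite partial functions whose values on `U` are those of `g`. -/
def agreeing (g : X → Fin q) (U : Set X) : Set (FinPartialFun X q) :=
  {φ | ∀ p ∈ φ.graph, p.1 ∈ U → g p.1 = p.2}

theorem measurable_graph [MeasurableSpace X] :
    Measurable[_, finsetBorel (X × Fin q)] (graph : FinPartialFun X q → _) :=
  comap_measurable _

theorem measurableSet_agreeing [MeasurableSpace X] {g : X → Fin q} (hg : Measurable g) {U : Set X}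
    (hU : MeasurableSet U) : MeasurableSet (agreeing g U) := by
  classical
  have hV : MeasurableSet {p : X × Fin q | p.1 ∈ U ∧ g p.1 ≠ p.2} :=
    (measurable_fst hU).inter (measurableSet_eq_fun (hg.comp measurable_fst) measurable_snd).compl
  have := (measurable_card_filter hV).comp (measurable_graph (X := X) (q := q))
    (measurableSet_singleton 0)
  convert! this using 1
  ext φ
  simp [agreeing, Finset.filter_eq_empty_iff]

theorem agreeing_congr {g g' : X → Fin q} {U U' : Set X} {φ : FinPartialFun X q}
    (hU : ∀ x ∈ φ.dom, x ∈ U ↔ x ∈ U') (hg : ∀ x ∈ φ.dom, x ∈ U → g x = g' x) :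
    φ ∈ agreeing g U ↔ φ ∈ agreeing g' U' := by
  refine forall_congr' fun p => forall_congr' fun hp => ?_
  have hpd : p.1 ∈ φ.dom := ⟨p.2, hp⟩
  rw [hU _ hpd]
  refine forall_congr' fun h => ?_
  rw [hg _ hpd ((hU _ hpd).2 h)]

/-- The partial function `x i ↦ b i`. -/
def ofTuple {k : ℕ} (x : {x : Fin k → X // Function.Injective x}) (b : Fin k → Fin q) :
    FinPartialFun X q :=
  ⟨Finset.univ.map ⟨fun i => (x.1 i, b i), fun _ _ h => x.2 (congrArg Prod.fst h)⟩, by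
    intro y i j hi hj
    obtain ⟨a, -, ha⟩ := Finset.mem_map.1 hi
    obtain ⟨a', -, ha'⟩ := Finset.mem_map.1 hj
    obtain ⟨h1, rfl⟩ := Prod.mk.inj ha
    obtain ⟨h2, rfl⟩ := Prod.mk.inj ha'
    rw [x.2 (h1.trans h2.symm)]⟩

theorem mem_graph_ofTuple {k : ℕ} (x : {x : Fin k → X // Function.Injective x})
    (b : Fin k → Fin q) (p : X × Fin q) :
    p ∈ (ofTuple x b).graph ↔ ∃ i, x.1 i = p.1 ∧ b i = p.2 := by
  refine Finset.mem_map.trans ⟨?_, ?_⟩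
  · rintro ⟨i, -, rfl⟩
    exact ⟨i, rfl, rfl⟩
  · rintro ⟨i, h1, h2⟩
    exact ⟨i, Finset.mem_univ _, Prod.ext h1 h2⟩

theorem ofTuple_injective {k : ℕ} (x : {x : Fin k → X // Function.Injective x}) :
    Function.Injective (ofTuple (q := q) x) := by
  intro b b' h
  funext i
  have : (x.1 i, b i) ∈ (ofTuple x b').graph := by
    rw [← h, mem_graph_ofTuple]; exact ⟨i, rfl, rfl⟩
  obtain ⟨j, h1, h2⟩ := (mem_graph_ofTuple _ _ _).1 this
  have h3 : j = i := x.2 h1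
  rw [← h3]
  rw [← h3] at h2
  exact h2.symm

theorem dom_ofTuple {k : ℕ} (x : {x : Fin k → X // Function.Injective x}) (b : Fin k → Fin q) :
    (ofTuple x b).dom = Set.range x.1 := by
  ext y
  simp only [dom, Set.mem_ofPred_eq, mem_graph_ofTuple, Set.mem_range]
  exact ⟨fun ⟨_, i, h, _⟩ => ⟨i, h⟩, fun ⟨i, h⟩ => ⟨_, i, h, rfl⟩⟩

theorem exists_ofTuple_eq {k : ℕ} (x : {x : Fin k → X // Function.Injective x})
    {φ : FinPartialFun X q} (h : φ.dom = Set.range x.1) : ∃ b, ofTuple x b = φ := by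
  have : ∀ i, ∃ j, (x.1 i, j) ∈ φ.graph := fun i => by
    have : x.1 i ∈ φ.dom := h ▸ ⟨i, rfl⟩
    exact this
  choose b hb using this
  refine ⟨b, FinPartialFun.ext (Finset.ext fun p => ?_)⟩
  rw [mem_graph_ofTuple]
  constructor
  · rintro ⟨i, h1, h2⟩
    have := hb i
    rwa [h1, h2] at this
  · intro hp
    have : p.1 ∈ Set.range x.1 := h ▸ ⟨p.2, hp⟩
    obtain ⟨i, hi⟩ := this
    refine ⟨i, hi, φ.functional p.1 _ _ ?_ hp⟩
    rw [← hi]; exact hb i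

theorem measurable_ofTuple [MeasurableSpace X] {k : ℕ} (b : Fin k → Fin q) :
    Measurable fun x : {x : Fin k → X // Function.Injective x} => ofTuple x b := by
  refine measurable_comap_iff.2 ?_
  refine measurable_finset_map _ (fun (x : {x : Fin k → X // Function.Injective x}) i =>
    (x.1 i, b i)) (fun i => ?_) (fun x _ _ h => x.2 (congrArg Prod.fst h))
  · exact ((measurable_pi_apply i).comp measurable_subtype_coe).prodMk measurable_const

end FinPartialFun

namespace CSPConstraint

variable {X : Type*} {q : ℕ}

/-- The constraint with domain `{x i}` whose forbidden colorings are the `x i ↦ b i`, `b ∈ β`. -/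
def ofTuple {k : ℕ} (x : {x : Fin k → X // Function.Injective x})
    (β : Finset (Fin k → Fin q)) : CSPConstraint X q where
  dom := Finset.univ.map ⟨x.1, x.2⟩
  bad := β.map ⟨FinPartialFun.ofTuple x, FinPartialFun.ofTuple_injective x⟩
  dom_eq := by
    intro φ hφ
    obtain ⟨b, -, rfl⟩ := Finset.mem_map.1 hφ
    simp [FinPartialFun.dom_ofTuple]

/-- There are only countably many pairs `(k, β)`, and for each of them the constraints are
parametrized by a standard Borel space of tuples. This transfers the projection theorem to
constraints. -/
theorem exists_ofTuple_eq (B : CSPConstraint X q) :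
    ∃ (k : ℕ) (β : Finset (Fin k → Fin q)) (x : {x : Fin k → X // Function.Injective x}),
      ofTuple x β = B := by
  classical
  let x : {x : Fin B.dom.card → X // Function.Injective x} :=
    ⟨fun i => B.dom.equivFin.symm i, Subtype.val_injective.comp B.dom.equivFin.symm.injective⟩
  have hx : Set.range x.1 = (B.dom : Set X) := by
    ext y
    constructor
    · rintro ⟨i, rfl⟩
      exact (B.dom.equivFin.symm i).2
    · intro hy
      exact ⟨B.dom.equivFin ⟨y, hy⟩, by simp [x]⟩
  refine ⟨_, Finset.univ.filter fun b => FinPartialFun.ofTuple x b ∈ B.bad, x, ?_⟩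
  refine CSPConstraint.ext ?_ ?_
  · rw [← Finset.coe_inj, ← hx]
    simp [ofTuple]
  · ext φ
    simp only [ofTuple, Finset.mem_map, Finset.mem_filter, Finset.mem_univ, true_and,
      Function.Embedding.coeFn_mk]
    constructor
    · rintro ⟨b, hb, rfl⟩
      exact hb
    · intro hφ
      obtain ⟨b, rfl⟩ := FinPartialFun.exists_ofTuple_eq x ((B.dom_eq φ hφ).trans hx.symm)
      exact ⟨b, hφ, rfl⟩

variable [MeasurableSpace X]

theorem measurable_dom : Measurable[_, finsetBorel X] (dom : CSPConstraint X q → Finset X) := by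
  let _ : MeasurableSpace (Finset X) := finsetBorel X
  let _ : MeasurableSpace (Finset (FinPartialFun X q)) := finsetBorel _
  exact measurable_fst.comp (comap_measurable fun B : CSPConstraint X q => (B.dom, B.bad))

theorem measurable_bad :
    Measurable[_, finsetBorel (FinPartialFun X q)] (bad : CSPConstraint X q → Finset _) := by
  let _ : MeasurableSpace (Finset X) := finsetBorel X
  let _ : MeasurableSpace (Finset (FinPartialFun X q)) := finsetBorel _
  exact measurable_snd.comp (comap_measurable fun B : CSPConstraint X q => (B.dom, B.bad))

theorem measurable_ofTuple {k : ℕ} (β : Finset (Fin k → Fin q)) :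
    Measurable fun x : {x : Fin k → X // Function.Injective x} => ofTuple x β := by
  refine measurable_comap_iff.2 ?_
  refine @Measurable.prodMk _ _ _ _ (finsetBorel X) (finsetBorel (FinPartialFun X q)) _ _ ?_ ?_
  · exact measurable_finset_map _ (fun (x : {x : Fin k → X // Function.Injective x}) => x.1)
      (fun i => (measurable_pi_apply i).comp measurable_subtype_coe) (fun x => x.2)
  · exact measurable_finset_map _ (fun (x : {x : Fin k → X // Function.Injective x}) b =>
      FinPartialFun.ofTuple x b) (fun b => FinPartialFun.measurable_ofTuple b)
      (fun x => FinPartialFun.ofTuple_injective x)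

/-- A point lies outside the finite domain exactly when some `U n` contains it and misses the
domain. -/
theorem measurableSet_mem_dom [StandardBorelSpace X] :
    MeasurableSet {p : X × CSPConstraint X q | p.1 ∈ p.2.dom} := by
  classical
  obtain ⟨U, hU, hsep⟩ := MeasureTheory.exists_seq_measurableSet_separating X
  have h1 : {p : X × CSPConstraint X q | p.1 ∈ p.2.dom} =
      ⋂ n, {p | p.1 ∈ (U n)ᶜ} ∪ {p | (p.2.dom.filter (· ∈ U n)).card ∈ ({0}ᶜ : Set ℕ)} := by
    ext ⟨x, B⟩
    simp only [Set.mem_ofPred_eq, Set.mem_iInter, Set.mem_union, Set.mem_compl_iff,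
      Set.mem_singleton_iff, Finset.card_eq_zero, Finset.filter_eq_empty_iff, not_forall]
    constructor
    · intro hx n
      by_cases hn : x ∈ U n
      · exact Or.inr ⟨x, hx, by simpa using hn⟩
      · exact Or.inl hn
    · intro h
      by_contra hx
      obtain ⟨n, h1, h2⟩ := hsep {x} B.dom (Set.finite_singleton x) B.dom.finite_toSet
        (by simpa using hx)
      rcases h n with h3 | ⟨y, hy, h3⟩
      · exact h3 (h1 rfl)
      · exact Set.disjoint_left.1 h2 hy (not_not.1 h3)
  rw [h1]
  refine MeasurableSet.iInter fun n => MeasurableSet.union (measurable_fst (hU n).compl) ?_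
  exact ((measurable_card_filter (hU n)).comp (measurable_dom.comp measurable_snd))
    (MeasurableSet.singleton 0).compl

/-- A Borel set of pairs whose sections are finite sets of constraints has a Borel projection. -/
theorem measurableSet_exists [StandardBorelSpace X] {Y : Type*} [MeasurableSpace Y]
    [StandardBorelSpace Y] {Q : Y → CSPConstraint X q → Prop}
    (hQ : MeasurableSet {p : Y × CSPConstraint X q | Q p.1 p.2})
    (hfin : ∀ y, {B | Q y B}.Finite) : MeasurableSet {y | ∃ B, Q y B} := by
  have h1 : {y | ∃ B, Q y B} = ⋃ k : ℕ, ⋃ β : Finset (Fin k → Fin q),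
      {y | ∃ x : {x : Fin k → X // Function.Injective x}, Q y (ofTuple x β)} := by
    ext y
    simp only [Set.mem_ofPred_eq, Set.mem_iUnion]
    constructor
    · rintro ⟨B, hB⟩
      obtain ⟨k, β, x, rfl⟩ := exists_ofTuple_eq B
      exact ⟨k, β, x, hB⟩
    · rintro ⟨k, β, x, hx⟩
      exact ⟨_, hx⟩
  rw [h1]
  refine MeasurableSet.iUnion fun k => MeasurableSet.iUnion fun β =>
    MeasureTheory.measurableSet_exists_of_finite ?_ fun y => ?_
  · exact (measurable_fst.prodMk ((measurable_ofTuple β).comp measurable_snd)) hQ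
  -- The admissible tuples have entries in the domain of one of finitely many constraints.
  · refine ((hfin y).biUnion (t := fun B =>
      {x : {x : Fin k → X // Function.Injective x} | ∀ i, x.1 i ∈ B.dom}) fun B _ => ?_).subset ?_
    · refine Set.Finite.preimage (f := Subtype.val) (s := {x : Fin k → X | ∀ i, x i ∈ B.dom})
        Subtype.val_injective.injOn ?_
      exact Set.Finite.pi' fun _ => B.dom.finite_toSet
    · intro x hx
      simp only [Set.mem_iUnion]
      exact ⟨_, hx, fun i => by simp [ofTuple]⟩

/-! ### Conditional probabilities and recolouring of one finite class. -/

open Classical in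
/-- The conditional probability that `B` is violated, given that the colors on `U` are those
of `g`. -/
noncomputable def weight (B : CSPConstraint X q) (g : X → Fin q) (U : Set X) : ℝ :=
  ((B.bad.filter (· ∈ FinPartialFun.agreeing g U)).card : ℝ) /
    (q : ℝ) ^ (B.dom.filter (· ∉ U)).card

omit [MeasurableSpace X] in
theorem weight_def (B : CSPConstraint X q) (g : X → Fin q) (U : Set X)
    [DecidablePred (· ∈ FinPartialFun.agreeing g U)] [DecidablePred (· ∉ U)] :
    B.weight g U = ((B.bad.filter (· ∈ FinPartialFun.agreeing g U)).card : ℝ) /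
      (q : ℝ) ^ (B.dom.filter (· ∉ U)).card := by
  unfold weight
  congr!

theorem measurable_weight {g : X → Fin q} (hg : Measurable g) {U : Set X} (hU : MeasurableSet U) :
    Measurable fun B : CSPConstraint X q => B.weight g U := by
  classical
  have h1 : Measurable fun B : CSPConstraint X q =>
      (B.bad.filter (· ∈ FinPartialFun.agreeing g U)).card :=
    (measurable_card_filter (FinPartialFun.measurableSet_agreeing hg hU)).comp measurable_bad
  have h2 : Measurable fun B : CSPConstraint X q => (B.dom.filter (· ∉ U)).card := by
    have := (measurable_card_filter hU.compl).comp (measurable_dom (q := q))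
    convert! this using 1
    funext B
    simp only [Function.comp_apply]
    congr!
  simp only [weight_def]
  refine Measurable.div ?_ ?_
  · exact (measurable_from_top (f := fun n : ℕ => (n : ℝ))).comp h1
  · exact (measurable_from_top (f := fun n : ℕ => (q : ℝ) ^ n)).comp h2

end CSPConstraint

namespace FinPartialFun

variable {X : Type*} {q : ℕ}

theorem exists_extension (φ : FinPartialFun X q) (f : X → Fin q) :
    ∃ b : X → Fin q, ∀ p ∈ φ.graph, b p.1 = p.2 := by
  classical
  refine ⟨fun x => if h : ∃ i, (x, i) ∈ φ.graph then h.choose else f x, fun p hp => ?_⟩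
  have h : ∃ i, (p.1, i) ∈ φ.graph := ⟨p.2, hp⟩
  simp only [dif_pos h]
  exact φ.functional _ _ _ h.choose_spec hp

theorem mem_agreeing_iff {φ : FinPartialFun X q} {b : X → Fin q}
    (hb : ∀ p ∈ φ.graph, b p.1 = p.2) {g : X → Fin q} {U : Set X} :
    φ ∈ agreeing g U ↔ ∀ x ∈ φ.dom, x ∈ U → g x = b x := by
  constructor
  · rintro h x ⟨i, hi⟩ hx
    rw [h _ hi hx, hb _ hi]
  · intro h p hp hU
    rw [h p.1 ⟨p.2, hp⟩ hU, hb p hp]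

end FinPartialFun

namespace CSPConstraint

variable {X : Type*} {q : ℕ}

/-- Locality: only the colours on the domain matter. This yields independence in the Local Lemma and
allows the classes of one stage to be treated separately. -/
theorem weight_congr (B : CSPConstraint X q) {g g' : X → Fin q} {U U' : Set X}
    (hU : ∀ x ∈ B.dom, x ∈ U ↔ x ∈ U') (hg : ∀ x ∈ B.dom, x ∈ U → g x = g' x) :
    B.weight g U = B.weight g' U' := by
  classical
  rw [weight_def, weight_def, Finset.filter_congr (q := fun φ => φ ∈ FinPartialFun.agreeing g' U'),
    Finset.filter_congr (q := fun x => x ∉ U')]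
  · exact fun x hx => not_congr (hU x hx)
  · intro φ hφ
    have hd : ∀ x ∈ φ.dom, x ∈ B.dom := fun x hx => by
      rw [B.dom_eq φ hφ] at hx; exact hx
    exact FinPartialFun.agreeing_congr (fun x hx => hU x (hd x hx)) fun x hx => hg x (hd x hx)

theorem weight_nonneg (B : CSPConstraint X q) (g : X → Fin q) (U : Set X) : 0 ≤ B.weight g U := by
  unfold weight
  positivity

theorem weight_empty (B : CSPConstraint X q) (g : X → Fin q) :
    B.weight g ∅ = (B.bad.card : ℝ) / (q : ℝ) ^ B.dom.card := by
  classical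
  rw [weight_def, Finset.filter_true_of_mem, Finset.filter_true_of_mem]
  · exact fun x _ => Set.notMem_empty _
  · exact fun φ _ p _ h => absurd h (Set.notMem_empty _)

/-- Once the whole domain is coloured, the weight counts the forbidden colourings matching `g`, so a
weight below 1 excludes violation. -/
theorem one_le_weight_of_violates {B : CSPConstraint X q} {g : X → Fin q} {U : Set X}
    (hU : ∀ x ∈ B.dom, x ∈ U) (h : B.Violates g) : 1 ≤ B.weight g U := by
  classical
  have h2 : 0 < (B.bad.filter (· ∈ FinPartialFun.agreeing g U)).card := by
    refine Finset.card_pos.2 ⟨FinPartialFun.restrict g B.dom, Finset.mem_filter.2 ⟨h, ?_⟩⟩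
    intro p hp _
    obtain ⟨x, -, rfl⟩ := Finset.mem_map.1 hp
    rfl
  rw [weight_def, Finset.filter_false_of_mem (s := B.dom) fun x hx hx' => hx' (hU x hx),
    Finset.card_empty, pow_zero, div_one]
  exact_mod_cast h2

/-- If no forbidden colouring is compatible with the colours so far, none becomes compatible when
more points are coloured. -/
theorem weight_eq_zero_of_subset {B : CSPConstraint X q} {f g : X → Fin q} {U V : Set X}
    (hq : 0 < q) (hUV : U ⊆ V) (hfg : ∀ x ∈ B.dom, x ∈ U → f x = g x) (h : B.weight f U = 0) :
    B.weight g V = 0 := by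
  classical
  rw [B.weight_congr (fun _ _ => Iff.rfl) hfg] at h
  rw [weight_def] at h ⊢
  have hq' : (q : ℝ) ≠ 0 := by positivity
  rw [div_eq_zero_iff, or_iff_left (pow_ne_zero _ hq'), Nat.cast_eq_zero,
    Finset.card_eq_zero, Finset.filter_eq_empty_iff] at h
  rw [div_eq_zero_iff]
  left
  rw [Nat.cast_eq_zero, Finset.card_eq_zero, Finset.filter_eq_empty_iff]
  exact fun φ hφ hmem => h hφ fun p hp hpU => hmem p hp (hUV hpU)

open Classical in
/-- The coloring `f`, recolored on the finite set `S` by `ω`. -/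
noncomputable def recolor (f : X → Fin q) (S : Finset X) (ω : S → Fin q) : X → Fin q :=
  fun x => if h : x ∈ S then ω ⟨x, h⟩ else f x

theorem recolor_of_mem (f : X → Fin q) {S : Finset X} (ω : S → Fin q) (x : S) :
    recolor f S ω x = ω x := dif_pos x.2

theorem recolor_of_notMem (f : X → Fin q) {S : Finset X} (ω : S → Fin q) {x : X} (hx : x ∉ S) :
    recolor f S ω x = f x := dif_neg hx

theorem card_matching {ι κ : Type*} [Fintype ι] [DecidableEq ι] [Fintype κ] [DecidableEq κ]
    (D : ι → Prop) [DecidablePred D] (b : ι → κ) :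
    (Finset.univ.filter fun ω : ι → κ => ∀ i, D i → ω i = b i).card =
      Fintype.card κ ^ (Finset.univ.filter fun i => ¬ D i).card := by
  have : (Finset.univ.filter fun ω : ι → κ => ∀ i, D i → ω i = b i) =
      Fintype.piFinset fun i => if D i then {b i} else Finset.univ := by
    ext ω
    simp only [Finset.mem_filter, Finset.mem_univ, true_and, Fintype.mem_piFinset]
    refine forall_congr' fun i => ?_
    by_cases h : D i <;> simp [h]
  rw [this, Fintype.card_piFinset, ← Finset.prod_filter_mul_prod_filter_not _ D]
  rw [Finset.prod_eq_one, one_mul, Finset.prod_congr rfl (g := fun _ => Fintype.card κ),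
    Finset.prod_const]
  · intro i hi; simp [(Finset.mem_filter.1 hi).2]
  · intro i hi; simp [(Finset.mem_filter.1 hi).2]

/-- The conditional probability is a martingale: it is the average of its values after the finite
set `S` has been colored uniformly at random. -/
theorem sum_weight_recolor [DecidableEq X] (hq : 0 < q) (B : CSPConstraint X q) (f : X → Fin q) {U : Set X}
    {S : Finset X} (hSU : ∀ x ∈ S, x ∉ U) :
    ∑ ω : S → Fin q, B.weight (recolor f S ω) (U ∪ S) = (q : ℝ) ^ S.card * B.weight f U := by
  classical
  have hq' : (q : ℝ) ≠ 0 := by positivity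
  -- A forbidden `φ` compatible with `f` on `U` prescribes `ω` on the part of `S` inside the domain
  -- and leaves it free on the rest.
  have key : ∀ φ ∈ B.bad, (Finset.univ.filter fun ω : S → Fin q =>
      φ ∈ FinPartialFun.agreeing (recolor f S ω) (U ∪ S)).card =
      if φ ∈ FinPartialFun.agreeing f U then q ^ (S.filter (· ∉ B.dom)).card else 0 := by
    intro φ hφ
    obtain ⟨b, hb⟩ := φ.exists_extension f
    have hdom : ∀ x, x ∈ φ.dom ↔ x ∈ B.dom := fun x => by rw [B.dom_eq φ hφ]; rfl
    have h1 : ∀ ω : S → Fin q, φ ∈ FinPartialFun.agreeing (recolor f S ω) (U ∪ S) ↔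
        φ ∈ FinPartialFun.agreeing f U ∧ ∀ x : S, (x : X) ∈ B.dom → ω x = b x := by
      intro ω
      simp only [FinPartialFun.mem_agreeing_iff hb, hdom]
      constructor
      · refine fun h => ⟨fun x hx hU => ?_, fun x hx => ?_⟩
        · rw [← h x hx (Or.inl hU), recolor_of_notMem f ω fun hS => hSU x hS hU]
        · rw [← h x hx (Or.inr x.2), recolor_of_mem]
      · rintro ⟨h1, h2⟩ x hx (hU | hS)
        · rw [recolor_of_notMem f ω fun hS => hSU x hS hU, h1 x hx hU]
        · have := h2 ⟨x, hS⟩ hx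
          rw [← this, ← recolor_of_mem f ω ⟨x, hS⟩]
    simp only [h1]
    split_ifs with h
    · simp only [h, true_and]
      rw [card_matching (fun x : S => (x : X) ∈ B.dom) (fun x => b x), Fintype.card_fin]
      congr 1
      rw [← Finset.card_map (Function.Embedding.subtype _)]
      congr 1
      ext x
      simp [and_comm]
    · simp [h]
  -- Both sides count the union of `S` with the uncoloured part of the domain; this balances the
  -- powers of `q`.
  have hcount : S.card + (B.dom.filter (· ∉ (U ∪ S : Set X))).card =
      (S.filter (· ∉ B.dom)).card + (B.dom.filter (· ∉ U)).card := by
    have e1 : (S.filter (· ∈ B.dom)).card + (S.filter (· ∉ B.dom)).card = S.card :=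
      Finset.card_filter_add_card_filter_not _
    have e2 : (B.dom.filter (· ∉ U)).card =
        (B.dom.filter (· ∉ (U ∪ S : Set X))).card + (S.filter (· ∈ B.dom)).card := by
      rw [← Finset.card_union_of_disjoint]
      · congr 1
        ext x
        simp only [Finset.mem_filter, Finset.mem_union, Set.mem_union,
          Finset.mem_coe]
        have := hSU x
        tauto
      · rw [Finset.disjoint_left]
        intro x hx hx'
        exact (Finset.mem_filter.1 hx).2 (Or.inr (Finset.mem_filter.1 hx').1)
    omega
  have hsum : ∑ ω : S → Fin q, ((B.bad.filter
      (· ∈ FinPartialFun.agreeing (recolor f S ω) (U ∪ S))).card : ℝ) =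
      (B.bad.filter (· ∈ FinPartialFun.agreeing f U)).card *
        (q : ℝ) ^ (S.filter (· ∉ B.dom)).card := by
    have : ∑ ω : S → Fin q, (B.bad.filter
        (· ∈ FinPartialFun.agreeing (recolor f S ω) (U ∪ S))).card =
        (B.bad.filter (· ∈ FinPartialFun.agreeing f U)).card *
          q ^ (S.filter (· ∉ B.dom)).card := by
      simp only [Finset.card_filter]
      rw [Finset.sum_comm, Finset.sum_mul]
      refine Finset.sum_congr rfl fun φ hφ => ?_
      have := key φ hφ
      rw [Finset.card_filter] at this
      rw [this]
      simp [Finset.card_filter]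
    exact_mod_cast this
  have h1 : ∀ ω : S → Fin q, B.weight (recolor f S ω) (U ∪ S) =
      ((B.bad.filter (· ∈ FinPartialFun.agreeing (recolor f S ω) (U ∪ S))).card : ℝ) /
        (q : ℝ) ^ (B.dom.filter (· ∉ (U ∪ S : Set X))).card := fun ω => weight_def _ _ _
  have h2 : B.weight f U = ((B.bad.filter (· ∈ FinPartialFun.agreeing f U)).card : ℝ) /
        (q : ℝ) ^ (B.dom.filter (· ∉ U)).card := weight_def _ _ _
  simp only [h1]
  rw [← Finset.sum_div, hsum, h2, div_eq_iff (pow_ne_zero _ hq'), mul_div_assoc', div_mul_eq_mul_div,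
    eq_div_iff (pow_ne_zero _ hq'), mul_assoc, ← pow_add, ← hcount, pow_add]
  ring

/-- A finite set `S` of uncolored points can be colored so that the conditional probabilities of
the constraints of a finite family with dependency degree at most `d` all drop to zero or grow by
less than the factor `e (d + 1)`. -/
theorem exists_recolor (hq : 0 < q) (f : X → Fin q) {U : Set X} {S : Finset X}
    (hSU : ∀ x ∈ S, x ∉ U) {𝓚 : Set (CSPConstraint X q)} (h𝓚 : 𝓚.Finite) (d : ℕ)
    (hd : ∀ B ∈ 𝓚, {B' | B' ∈ 𝓚 ∧ B ≠ B' ∧ ∃ x, x ∈ B'.dom ∧ x ∈ B.dom}.encard ≤ d) :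
    ∃ g : X → Fin q, (∀ x ∉ S, g x = f x) ∧ ∀ B ∈ 𝓚,
      B.weight g (U ∪ S) = 0 ∨ B.weight g (U ∪ S) < B.weight f U * (Real.exp 1 * (d + 1)) := by
  classical
  let K : ℝ := Real.exp 1 * (d + 1)
  have hK : 0 < K := by positivity
  -- The event to avoid. Requiring a nonzero weight makes it empty when the weight was zero
  -- beforehand, where the inequality alone would hold trivially.
  let A : CSPConstraint X q → Finset (S → Fin q) := fun B => Finset.univ.filter fun ω =>
    B.weight (recolor f S ω) (U ∪ S) ≠ 0 ∧
      B.weight f U * K ≤ B.weight (recolor f S ω) (U ∪ S)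
  let N : CSPConstraint X q → Finset (CSPConstraint X q) := fun B =>
    h𝓚.toFinset.filter fun B' => B ≠ B' ∧ ∃ x, x ∈ B'.dom ∧ x ∈ B.dom
  have : Nonempty (Fin q) := ⟨⟨0, hq⟩⟩
  have hAcongr : ∀ B, ∀ ω ω' : S → Fin q, (∀ x : S, (x : X) ∈ B.dom → ω x = ω' x) →
      (ω ∈ A B ↔ ω' ∈ A B) := by
    intro B ω ω' h
    have : B.weight (recolor f S ω) (U ∪ S) = B.weight (recolor f S ω') (U ∪ S) := by
      refine B.weight_congr (fun _ _ => Iff.rfl) fun x hx _ => ?_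
      by_cases hS : x ∈ S
      · rw [recolor_of_mem f ω ⟨x, hS⟩, recolor_of_mem f ω' ⟨x, hS⟩, h ⟨x, hS⟩ hx]
      · rw [recolor_of_notMem f ω hS, recolor_of_notMem f ω' hS]
    simp only [A, Finset.mem_filter, Finset.mem_univ, true_and, this]
  suffices h : ∃ ω, ∀ B ∈ h𝓚.toFinset, ω ∉ A B by
    obtain ⟨ω, hω⟩ := h
    refine ⟨recolor f S ω, fun x hx => recolor_of_notMem f ω hx, fun B hB => ?_⟩
    have := hω B (h𝓚.mem_toFinset.2 hB)
    simp only [A, Finset.mem_filter, Finset.mem_univ, true_and, not_and, not_le] at this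
    by_cases h : B.weight (recolor f S ω) (U ∪ S) = 0
    · exact Or.inl h
    · exact Or.inr (this h)
  refine LocalLemma.exists_avoiding h𝓚.toFinset A N d ?_ ?_ ?_
  · intro B hB
    have h1 := hd B (h𝓚.mem_toFinset.1 hB)
    have h2 : {B' | B' ∈ 𝓚 ∧ B ≠ B' ∧ ∃ x, x ∈ B'.dom ∧ x ∈ B.dom} = (N B : Set _) := by
      ext B'; simp [N]
    rw [h2, Set.encard_coe_eq_coe_finsetCard] at h1
    exact_mod_cast h1
  · intro B hB J hJ hBJ hdisj
    refine LocalLemma.card_inter_mul_card {x : S | (x : X) ∈ B.dom} _ _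
      (fun ω ω' h => hAcongr B ω ω' h) fun ω ω' h => ?_
    simp only [LocalLemma.mem_avoid]
    refine forall_congr' fun B' => forall_congr' fun hB' => not_congr (hAcongr B' ω ω' ?_)
    intro x hx
    refine h x fun hxB => ?_
    refine Finset.disjoint_left.1 hdisj hB' (Finset.mem_filter.2 ⟨hJ hB', ?_, x, hx, hxB⟩)
    rintro rfl
    exact hBJ hB'
  · intro B hB
    rcases (B.weight_nonneg f U).eq_or_lt with h0 | h0
    · have : A B = ∅ := by
        refine Finset.filter_false_of_mem fun ω _ h => h.1 ?_
        refine weight_eq_zero_of_subset hq Set.subset_union_left (fun x _ hx => ?_) h0.symm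
        rw [recolor_of_notMem f ω fun hS => hSU x hS hx]
      rw [this]
      simp
    -- Markov's inequality, the mean of the new weight being the old one.
    · have h1 : ((A B).card : ℝ) * (B.weight f U * K) ≤ (q : ℝ) ^ S.card * B.weight f U := by
        rw [← sum_weight_recolor hq B f hSU, ← nsmul_eq_mul]
        calc (A B).card • (B.weight f U * K)
            ≤ ∑ ω ∈ A B, B.weight (recolor f S ω) (U ∪ S) :=
              Finset.card_nsmul_le_sum _ _ _ fun ω hω => (Finset.mem_filter.1 hω).2.2
          _ ≤ _ := Finset.sum_le_univ_sum_of_nonneg fun ω => B.weight_nonneg _ _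
      have h2 : (Fintype.card (S → Fin q) : ℝ) = (q : ℝ) ^ S.card := by simp
      rw [h2]
      refine le_of_mul_le_mul_right ?_ h0
      calc ((A B).card : ℝ) * K * B.weight f U = (A B).card * (B.weight f U * K) := by ring
        _ ≤ _ := h1

end CSPConstraint

/-! ### The Borel colouring, class by class. -/

section FiniteSections

variable {X : Type*} [MeasurableSpace X] [StandardBorelSpace X]

theorem measurableSet_comp_of_finite {A C : X → X → Prop}
    (hA : MeasurableSet {p : X × X | A p.1 p.2}) (hAfin : ∀ x, {y | A x y}.Finite)
    (hC : MeasurableSet {p : X × X | C p.1 p.2}) :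
    MeasurableSet {p : X × X | ∃ y, A p.1 y ∧ C y p.2} := by
  refine MeasureTheory.measurableSet_exists_of_finite
    (A := fun (p : X × X) y => A p.1 y ∧ C y p.2) ?_ fun p => (hAfin p.1).subset fun y hy => hy.1
  refine MeasurableSet.inter ?_ ?_
  · exact (show Measurable fun p : (X × X) × X => (p.1.1, p.2) by fun_prop) hA
  · exact (show Measurable fun p : (X × X) × X => (p.2, p.1.2) by fun_prop) hC

theorem measurableSet_exists_mem_of_finite {A : X → X → Prop}
    (hA : MeasurableSet {p : X × X | A p.1 p.2}) (hAfin : ∀ x, {y | A x y}.Finite)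
    {T : Set X} (hT : MeasurableSet T) : MeasurableSet {x | ∃ y, A x y ∧ y ∈ T} :=
  MeasureTheory.measurableSet_exists_of_finite (A := fun x y => A x y ∧ y ∈ T)
    (hA.inter (measurable_snd hT)) fun x => (hAfin x).subset fun _ hy => hy.1

omit [MeasurableSpace X] [StandardBorelSpace X] in
theorem finite_comp {A C : X → X → Prop} (hA : ∀ x, {y | A x y}.Finite)
    (hC : ∀ x, {y | C x y}.Finite) (x : X) : {z | ∃ y, A x y ∧ C y z}.Finite := by
  refine ((hA x).biUnion fun y _ => hC y).subset ?_
  rintro z ⟨y, h1, h2⟩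
  simp only [Set.mem_iUnion]
  exact ⟨y, h1, h2⟩

end FiniteSections

namespace CSP

variable {X : Type*} {q : ℕ}

theorem finite_mem_dom {𝓑 : CSP X q} {d : ℕ}
    (hd : ∀ B ∈ 𝓑, {B' | B' ∈ 𝓑 ∧ B ≠ B' ∧ ∃ x, x ∈ B'.dom ∧ x ∈ B.dom}.encard ≤ d) (x : X) :
    {B | B ∈ 𝓑 ∧ x ∈ B.dom}.Finite := by
  rcases Set.eq_empty_or_nonempty {B | B ∈ 𝓑 ∧ x ∈ B.dom} with h | ⟨B, hB, hx⟩
  · rw [h]; exact Set.finite_empty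
  · have h1 : {B' | B' ∈ 𝓑 ∧ B ≠ B' ∧ ∃ x, x ∈ B'.dom ∧ x ∈ B.dom}.Finite :=
      Set.encard_lt_top_iff.1 ((hd B hB).trans_lt (ENat.natCast_lt_top d))
    refine (h1.insert B).subset ?_
    rintro B' ⟨hB', hx'⟩
    by_cases h : B' = B
    · exact Or.inl h
    · exact Or.inr ⟨hB', Ne.symm h, x, hx', hx⟩

theorem finite_exists_mem_dom {𝓑 : CSP X q} (hfin : ∀ x, {B | B ∈ 𝓑 ∧ x ∈ B.dom}.Finite) (x : X) :
    {y | ∃ B, B ∈ 𝓑 ∧ x ∈ B.dom ∧ y ∈ B.dom}.Finite := by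
  refine ((hfin x).biUnion (t := fun B => (B.dom : Set X)) fun B _ =>
    B.dom.finite_toSet).subset ?_
  rintro y ⟨B, hB, hx, hy⟩
  simp only [Set.mem_iUnion]
  exact ⟨B, ⟨hB, hx⟩, hy⟩

variable [MeasurableSpace X] [StandardBorelSpace X]

theorem measurableSet_exists_mem_dom {𝓑 : CSP X q} (h𝓑 : MeasurableSet 𝓑)
    (hfin : ∀ x, {B | B ∈ 𝓑 ∧ x ∈ B.dom}.Finite) :
    MeasurableSet {p : X × X | ∃ B, B ∈ 𝓑 ∧ p.1 ∈ B.dom ∧ p.2 ∈ B.dom} := by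
  refine CSPConstraint.measurableSet_exists
    (Q := fun (p : X × X) B => B ∈ 𝓑 ∧ p.1 ∈ B.dom ∧ p.2 ∈ B.dom) ?_ fun p =>
    (hfin p.1).subset fun B hB => ⟨hB.1, hB.2.1⟩
  refine (measurable_snd h𝓑).inter (MeasurableSet.inter ?_ ?_)
  · exact (show Measurable fun p : (X × X) × CSPConstraint X q => (p.1.1, p.2) by fun_prop)
      CSPConstraint.measurableSet_mem_dom
  · exact (show Measurable fun p : (X × X) × CSPConstraint X q => (p.1.2, p.2) by fun_prop)
      CSPConstraint.measurableSet_mem_dom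

/-- The classes of a finite Borel equivalence relation can be colored by natural numbers in a Borel
way, so that distinct classes met by a common constraint receive distinct colors. -/
theorem exists_block_numbering {𝓑 : CSP X q} (h𝓑 : MeasurableSet 𝓑)
    (hfin : ∀ x, {B | B ∈ 𝓑 ∧ x ∈ B.dom}.Finite) {E : X → X → Prop} (hE : Equivalence E)
    (hEm : MeasurableSet {p : X × X | E p.1 p.2}) (hEfin : ∀ x, {y | E x y}.Finite) :
    ∃ c : X → ℕ, Measurable c ∧ (∀ x y, E x y → c x = c y) ∧
      ∀ B ∈ 𝓑, ∀ x ∈ B.dom, ∀ y ∈ B.dom, c x = c y → E x y := by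
  classical
  obtain ⟨U, hU, hsep⟩ := MeasureTheory.exists_seq_measurableSet_separating X
  let G : X → X → Prop := fun x y => ∃ B, B ∈ 𝓑 ∧ x ∈ B.dom ∧ y ∈ B.dom
  have hGm : MeasurableSet {p : X × X | G p.1 p.2} := measurableSet_exists_mem_dom h𝓑 hfin
  have hGfin : ∀ x, {y | G x y}.Finite := finite_exists_mem_dom hfin
  -- `R x` is the finite set formed by the class of `x` and all points sharing a constraint with it.
  -- The number of a class is the least `n` for which `U n` cuts the class out of this set; a point
  -- of another class in it lies outside `U n`, so it cannot have the number `n`.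
  let R : X → X → Prop := fun x y => E x y ∨ ∃ z, E x z ∧ G z y
  have hRfin : ∀ x, {y | R x y}.Finite := fun x => (hEfin x).union (finite_comp hEfin hGfin x)
  have hRm : MeasurableSet {p : X × X | R p.1 p.2} :=
    hEm.union (measurableSet_comp_of_finite hEm hEfin hGm)
  let P : X → ℕ → Prop := fun x n => ∀ y, R x y → (E x y ↔ y ∈ U n)
  have hP : ∀ x, ∃ n, P x n := by
    intro x
    obtain ⟨n, h1, h2⟩ := hsep {y | E x y} {y | R x y ∧ ¬ E x y} (hEfin x)
      ((hRfin x).subset fun y hy => hy.1) (Set.disjoint_left.2 fun y h h' => h'.2 h)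
    refine ⟨n, fun y hy => ⟨fun h => h1 h, fun h => ?_⟩⟩
    by_contra hcon
    exact Set.disjoint_left.1 h2 ⟨hy, hcon⟩ h
  have hPm : ∀ n, MeasurableSet {x | P x n} := by
    intro n
    have h1 : MeasurableSet {p : X × X | R p.1 p.2 ∧ ¬ (E p.1 p.2 ↔ p.2 ∈ U n)} := by
      have h2 : MeasurableSet {p : X × X | p.2 ∈ U n} := measurable_snd (hU n)
      have h3 : {p : X × X | E p.1 p.2 ↔ p.2 ∈ U n} =
          ({p | E p.1 p.2} ∩ {p | p.2 ∈ U n}) ∪ ({p | E p.1 p.2}ᶜ ∩ {p | p.2 ∈ U n}ᶜ) := by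
        ext p
        simp only [Set.mem_union, Set.mem_inter_iff, Set.mem_compl_iff, Set.mem_ofPred_eq]
        tauto
      have h4 : MeasurableSet {p : X × X | E p.1 p.2 ↔ p.2 ∈ U n} := by
        rw [h3]
        exact (hEm.inter h2).union (hEm.compl.inter h2.compl)
      exact hRm.inter h4.compl
    have h4 := (MeasureTheory.measurableSet_exists_of_finite
      (A := fun x y => R x y ∧ ¬ (E x y ↔ y ∈ U n)) h1
      fun x => (hRfin x).subset fun y hy => hy.1).compl
    convert! h4 using 1
    ext x
    simp [P]
  have hPinv : ∀ x y, E x y → P x = P y := by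
    intro x y hxy
    funext n
    have h1 : ∀ z, E x z ↔ E y z := fun z => ⟨fun h => hE.trans (hE.symm hxy) h, hE.trans hxy⟩
    simp only [P, R, h1]
  have hcU : ∀ x, x ∈ U (Nat.find (hP x)) := fun x =>
    (Nat.find_spec (hP x) x (Or.inl (hE.refl x))).1 (hE.refl x)
  refine ⟨fun x => Nat.find (hP x), measurable_find hP hPm, fun x y hxy => ?_,
    fun B hB x hx y hy hxy => ?_⟩
  · have := hPinv x y hxy
    simp only [this]
  · have h1 := Nat.find_spec (hP x) y (Or.inr ⟨x, hE.refl x, B, hB, hx, hy⟩)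
    refine h1.2 ?_
    have h2 := hcU y
    have hxy' : Nat.find (hP x) = Nat.find (hP y) := hxy
    rw [← hxy'] at h2
    exact h2

/-- One stage of the construction: the classes of color `n` are colored simultaneously. -/
theorem exists_color_blocks (hq : 0 < q) {𝓑 : CSP X q} (h𝓑 : MeasurableSet 𝓑) {d : ℕ}
    (hd : ∀ B ∈ 𝓑, {B' | B' ∈ 𝓑 ∧ B ≠ B' ∧ ∃ x, x ∈ B'.dom ∧ x ∈ B.dom}.encard ≤ d)
    {E : X → X → Prop} (hE : Equivalence E)
    (hEm : MeasurableSet {p : X × X | E p.1 p.2}) (hEfin : ∀ x, {y | E x y}.Finite)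
    {c : X → ℕ} (hc : Measurable c) (hcE : ∀ x y, E x y → c x = c y)
    (hcB : ∀ B ∈ 𝓑, ∀ x ∈ B.dom, ∀ y ∈ B.dom, c x = c y → E x y)
    {f : X → Fin q} (hf : Measurable f) (n : ℕ) :
    ∃ f' : X → Fin q, Measurable f' ∧ (∀ x, c x ≠ n → f' x = f x) ∧
      ∀ B ∈ 𝓑, (∃ x ∈ B.dom, c x = n) → B.weight f' {x | c x < n + 1} = 0 ∨
        B.weight f' {x | c x < n + 1} < B.weight f {x | c x < n} * (Real.exp 1 * (d + 1)) := by
  classical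
  have hfin := finite_mem_dom hd
  obtain ⟨h, hh, hdense⟩ := MeasureTheory.exists_seq_measurable_dense X hq
  have hUm : ∀ m, MeasurableSet {x | c x < m} := fun m => measurableSet_lt hc measurable_const
  have hcn : MeasurableSet {x | c x = n} := hc (measurableSet_singleton n)
  let g : ℕ → X → Fin q := fun m x => if c x = n then h m x else f x
  have hg : ∀ m, Measurable (g m) := fun m => Measurable.ite hcn (hh m) hf
  let Good : (X → Fin q) → CSPConstraint X q → Prop := fun f' B =>
    B.weight f' {x | c x < n + 1} = 0 ∨
      B.weight f' {x | c x < n + 1} < B.weight f {x | c x < n} * (Real.exp 1 * (d + 1))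
  have hGood : ∀ m, MeasurableSet {B | Good (g m) B} := by
    intro m
    have h1 := CSPConstraint.measurable_weight (hg m) (hUm (n + 1))
    have h2 := CSPConstraint.measurable_weight hf (hUm n)
    exact (h1 (measurableSet_singleton 0)).union (measurableSet_lt h1 (h2.mul_const _))
  have hGcongr : ∀ f₁ f₂ B, (∀ x ∈ B.dom, c x < n + 1 → f₁ x = f₂ x) → (Good f₁ B ↔ Good f₂ B) := by
    intro f₁ f₂ B h12
    have : B.weight f₁ {x | c x < n + 1} = B.weight f₂ {x | c x < n + 1} :=
      B.weight_congr (fun _ _ => Iff.rfl) h12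
    simp only [Good, this]
  -- Candidate `m` fails for a class if some constraint touching the class grows too much. The
  -- condition depends only on the class, so taking the least successful `m` is consistent along it.
  let Bad : ℕ → X → Prop := fun m x => ∃ y, E x y ∧ y ∈ {y | ∃ B, (B ∈ 𝓑 ∧ y ∈ B.dom) ∧
    ¬ Good (g m) B}
  have hBad : ∀ m, MeasurableSet {x | Bad m x} := by
    intro m
    refine measurableSet_exists_mem_of_finite hEm hEfin ?_
    refine CSPConstraint.measurableSet_exists ?_ fun x => (hfin x).subset fun B hB => hB.1
    exact ((measurable_snd h𝓑).inter CSPConstraint.measurableSet_mem_dom).inter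
      (measurable_snd (hGood m).compl)
  let P : ℕ → X → Prop := fun m x => c x = n → ¬ Bad m x
  have hPm : ∀ m, MeasurableSet {x | P m x} := by
    intro m
    have := hcn.compl.union (hBad m).compl
    convert! this using 1
    ext x
    simp only [P, Set.mem_union, Set.mem_compl_iff, Set.mem_ofPred_eq]
    tauto
  have hPex : ∀ x, ∃ m, P m x := by
    intro x
    by_cases hcx : c x = n
    swap
    · exact ⟨0, fun h => absurd h hcx⟩
    let S : Finset X := (hEfin x).toFinset
    have hS : ∀ y, y ∈ S ↔ E x y := fun y => (hEfin x).mem_toFinset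
    let 𝓚 : Set (CSPConstraint X q) := {B | B ∈ 𝓑 ∧ ∃ y ∈ S, y ∈ B.dom}
    have h𝓚 : 𝓚.Finite := by
      refine (S.finite_toSet.biUnion fun y _ => hfin y).subset ?_
      rintro B ⟨hB, y, hy, hyB⟩
      simp only [Set.mem_iUnion]
      exact ⟨y, hy, hB, hyB⟩
    obtain ⟨g', hg'1, hg'2⟩ := CSPConstraint.exists_recolor hq f (U := {x | c x < n}) (S := S)
      (fun y hy => by
        have := hcE x y ((hS y).1 hy)
        simp only [Set.mem_ofPred_eq]; omega) h𝓚 d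
      (fun B hB => (Set.encard_le_encard fun B' hB' =>
        show B' ∈ {B' | B' ∈ 𝓑 ∧ B ≠ B' ∧ ∃ x, x ∈ B'.dom ∧ x ∈ B.dom} from
          ⟨hB'.1.1, hB'.2⟩).trans (hd B hB.1))
    obtain ⟨m, hm⟩ := hdense S g' S.finite_toSet
    refine ⟨m, fun _ => ?_⟩
    rintro ⟨y, hxy, B, ⟨hB, hyB⟩, hnot⟩
    apply hnot
    -- A constraint meeting `S` meets no other class numbered `n`, so on its domain colouring `S`
    -- alone amounts to completing the stage.
    have hU : ∀ z ∈ B.dom, z ∈ ({x | c x < n} ∪ S : Set X) ↔ z ∈ {x | c x < n + 1} := by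
      intro z hz
      simp only [Set.mem_union, Set.mem_ofPred_eq, Finset.mem_coe, hS]
      constructor
      · rintro (h1 | h1)
        · omega
        · rw [← hcE x z h1]; omega
      · intro h1
        rcases Nat.lt_succ_iff_lt_or_eq.1 h1 with h2 | h2
        · exact Or.inl h2
        · refine Or.inr (hE.trans hxy (hcB B hB y hyB z hz ?_))
          rw [← hcE x y hxy, hcx, h2]
    have h1 := hg'2 B ⟨hB, y, (hS y).2 hxy, hyB⟩
    rw [B.weight_congr hU (g' := g m)] at h1
    · exact h1
    · intro z hz hzU
      by_cases hzS : z ∈ S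
      · have : c z = n := by rw [← hcE x z ((hS z).1 hzS), hcx]
        simp only [g, if_pos this]
        exact (hm z hzS).symm
      · have : c z ≠ n := fun h2 => hzS <| by
          rw [hS]
          refine hE.trans hxy (hcB B hB y hyB z hz ?_)
          rw [← hcE x y hxy, hcx, h2]
        simp only [g, if_neg this]
        exact hg'1 z hzS
  have hPinv : ∀ x y, E x y → (fun m => P m x) = fun m => P m y := by
    intro x y hxy
    have h1 : ∀ z, E x z ↔ E y z := fun z => ⟨fun h => hE.trans (hE.symm hxy) h, hE.trans hxy⟩
    funext m
    simp only [P, Bad, h1, hcE x y hxy]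
  have hfind : ∀ x y, E x y → Nat.find (hPex x) = Nat.find (hPex y) := by
    intro x y hxy
    have := hPinv x y hxy
    refine le_antisymm (Nat.find_min' _ ?_) (Nat.find_min' _ ?_)
    · exact (congrFun this _).mpr (Nat.find_spec (hPex y))
    · exact (congrFun this _).mp (Nat.find_spec (hPex x))
  refine ⟨fun x => g (Nat.find (hPex x)) x, Measurable.find hg hPm hPex, fun x hx => if_neg hx, ?_⟩
  rintro B hB ⟨x, hx, hcx⟩
  have h1 := Nat.find_spec (hPex x) hcx
  have h2 : Good (g (Nat.find (hPex x))) B := by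
    by_contra hcon
    exact h1 ⟨x, hE.refl x, B, ⟨hB, hx⟩, hcon⟩
  refine (hGcongr _ _ B fun y hy _ => ?_).1 h2
  by_cases hcy : c y = n
  · rw [hfind x y (hcB B hB x hx y hy (hcx.trans hcy.symm))]
  · simp only [g, if_neg hcy]

/-- A Borel CSP whose constraints meet at most `s` classes of a finite Borel equivalence relation
has a Borel solution if `p (e (d + 1)) ^ s ≤ 1`. -/
theorem hasBorelSolution_of_equivalence (hq : 0 < q) {𝓑 : CSP X q} (h𝓑 : MeasurableSet 𝓑) {d : ℕ}
    (hd : ∀ B ∈ 𝓑, {B' | B' ∈ 𝓑 ∧ B ≠ B' ∧ ∃ x, x ∈ B'.dom ∧ x ∈ B.dom}.encard ≤ d)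
    {E : X → X → Prop} (hE : Equivalence E)
    (hEm : MeasurableSet {p : X × X | E p.1 p.2}) (hEfin : ∀ x, {y | E x y}.Finite)
    {s : ℕ} (hs : 0 < s)
    (hsE : ∀ B ∈ 𝓑, ∀ T ⊆ B.dom, (∀ x ∈ T, ∀ y ∈ T, E x y → x = y) → T.card ≤ s)
    (hp : ∀ B ∈ 𝓑, (B.bad.card : ℝ) / (q : ℝ) ^ B.dom.card * (Real.exp 1 * (d + 1)) ^ s ≤ 1) :
    𝓑.HasBorelSolution := by
  classical
  obtain ⟨c, hc, hcE, hcB⟩ := exists_block_numbering h𝓑 (finite_mem_dom hd) hE hEm hEfin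
  set K : ℝ := Real.exp 1 * (d + 1) with hKdef
  have hK : 1 < K := by
    have h1 : (1 : ℝ) < Real.exp 1 := Real.one_lt_exp_iff.2 one_pos
    have h2 : (0 : ℝ) ≤ d := Nat.cast_nonneg d
    nlinarith
  choose step hstep using fun (n : ℕ) (f : {f : X → Fin q // Measurable f}) =>
    exists_color_blocks hq h𝓑 hd hE hEm hEfin hc hcE hcB f.2 n
  let F : ℕ → {f : X → Fin q // Measurable f} := fun n =>
    Nat.rec ⟨fun _ => ⟨0, hq⟩, measurable_const⟩ (fun n f => ⟨step n f, (hstep n f).1⟩) n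
  have hF1 : ∀ n x, c x ≠ n → (F (n + 1)).1 x = (F n).1 x := fun n => (hstep n (F n)).2.1
  have hF2 : ∀ n, ∀ B ∈ 𝓑, (∃ x ∈ B.dom, c x = n) →
      B.weight (F (n + 1)).1 {x | c x < n + 1} = 0 ∨
        B.weight (F (n + 1)).1 {x | c x < n + 1} < B.weight (F n).1 {x | c x < n} * K :=
    fun n => (hstep n (F n)).2.2
  -- A point is coloured for good at the stage of its own number.
  let f : X → Fin q := fun x => (F (c x + 1)).1 x
  have hstab : ∀ n x, c x < n → (F n).1 x = f x := by
    intro n x hx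
    induction n with
    | zero => exact absurd hx (Nat.not_lt_zero _)
    | succ n ih =>
      rcases Nat.lt_succ_iff_lt_or_eq.1 hx with h | h
      · rw [hF1 n x h.ne, ih h]
      · simp only [f, h]
  have hf : Measurable f := by
    refine measurable_to_countable' fun i => ?_
    have : f ⁻¹' {i} = ⋃ n, c ⁻¹' {n} ∩ (F (n + 1)).1 ⁻¹' {i} := by
      ext x
      simp [f]
    rw [this]
    exact MeasurableSet.iUnion fun n => (hc (measurableSet_singleton n)).inter
      ((F (n + 1)).2 (measurableSet_singleton i))
  refine ⟨f, hf, fun B hB hviol => ?_⟩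
  let C : ℕ → Finset ℕ := fun n => (B.dom.image c).filter (· < n)
  let w0 : ℝ := (B.bad.card : ℝ) / (q : ℝ) ^ B.dom.card
  have hw0 : 0 ≤ w0 := by positivity
  -- `C n` lists the numbers met so far. Strictness after the first one makes the borderline case p
  -- K^s = 1 admissible.
  have key : ∀ n, B.weight f {x | c x < n} = 0 ∨ B.weight f {x | c x < n} ≤ w0 * K ^ (C n).card ∧
      ((C n).card ≠ 0 → B.weight f {x | c x < n} < w0 * K ^ (C n).card) := by
    intro n
    induction n with
    | zero =>
      right
      have h1 : C 0 = ∅ := by simp [C]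
      have h2 : {x | c x < 0} = (∅ : Set X) := by ext; simp
      rw [h1, h2, CSPConstraint.weight_empty]
      simp [w0]
    | succ n ih =>
      by_cases hn : ∃ x ∈ B.dom, c x = n
      · have hC : C (n + 1) = insert n (C n) := by
          ext a
          simp only [C, Finset.mem_filter, Finset.mem_insert, Finset.mem_image]
          constructor
          · rintro ⟨h1, h2⟩
            rcases Nat.lt_succ_iff_lt_or_eq.1 h2 with h | h
            · exact Or.inr ⟨h1, h⟩
            · exact Or.inl h
          · rintro (rfl | ⟨h1, h2⟩)
            · exact ⟨hn, Nat.lt_succ_self _⟩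
            · exact ⟨h1, Nat.lt_succ_of_lt h2⟩
        have hC' : (C (n + 1)).card = (C n).card + 1 := by
          rw [hC, Finset.card_insert_of_notMem]
          simp [C]
        have e1 : B.weight (F (n + 1)).1 {x | c x < n + 1} = B.weight f {x | c x < n + 1} :=
          B.weight_congr (fun _ _ => Iff.rfl) fun x _ hx => hstab _ _ hx
        have e2 : B.weight (F n).1 {x | c x < n} = B.weight f {x | c x < n} :=
          B.weight_congr (fun _ _ => Iff.rfl) fun x _ hx => hstab _ _ hx
        have h1 := hF2 n B hB hn
        rw [e1, e2] at h1
        rcases h1 with h1 | h1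
        · exact Or.inl h1
        · rcases ih with h2 | ⟨h2, -⟩
          · rw [h2, zero_mul] at h1
            exact absurd h1 (not_lt.2 (B.weight_nonneg _ _))
          · have h3 : B.weight f {x | c x < n + 1} < w0 * K ^ (C (n + 1)).card := by
              rw [hC', pow_succ, ← mul_assoc]
              exact h1.trans_le (mul_le_mul_of_nonneg_right h2 (by positivity))
            exact Or.inr ⟨h3.le, fun _ => h3⟩
      · push Not at hn
        have hC : C (n + 1) = C n := by
          ext a
          simp only [C, Finset.mem_filter, Finset.mem_image]
          refine and_congr_right ?_
          rintro ⟨x, hx, rfl⟩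
          have := hn x hx
          omega
        have e1 : B.weight f {x | c x < n + 1} = B.weight f {x | c x < n} := by
          refine B.weight_congr (fun x hx => ?_) fun _ _ _ => rfl
          have := hn x hx
          simp only [Set.mem_ofPred_eq]
          omega
        rw [hC, e1]
        exact ih
  let M := (B.dom.image c).sup id + 1
  have hM : ∀ x ∈ B.dom, x ∈ {x | c x < M} := fun x hx =>
    Nat.lt_succ_of_le (Finset.le_sup (f := id) (Finset.mem_image_of_mem c hx))
  have h1 := CSPConstraint.one_le_weight_of_violates hM hviol
  have hCs : (C M).card ≤ s := by
    refine (Finset.card_le_card (Finset.filter_subset _ _)).trans ?_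
    -- One point for each number on the domain: distinct numbers mean distinct classes, so there are
    -- at most `s` of them.
    obtain ⟨T, hT, hTinj, hTim⟩ := Finset.exists_subset_injOn_image_eq_of_surjOn B.dom
      (B.dom.image c) (f := c) (by rw [Finset.coe_image]; exact Set.surjOn_image _ _)
    rw [← hTim, Finset.card_image_of_injOn hTinj]
    exact hsE B hB T hT fun x hx y hy hxy => hTinj hx hy (hcE x y hxy)
  have hle : w0 * K ^ (C M).card ≤ w0 * K ^ s :=
    mul_le_mul_of_nonneg_left (pow_le_pow_right₀ hK.le hCs) hw0
  have hps : w0 * K ^ s ≤ 1 := hp B hB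
  rcases key M with h2 | ⟨h2, h3⟩
  · rw [h2] at h1
    exact absurd h1 (by norm_num)
  -- With an empty domain no strict step occurs; instead `K ^ s > 1`, from `0 < s`, forces `w0 < 1`.
  · by_cases h4 : (C M).card = 0
    · rw [h4, pow_zero, mul_one] at h2
      have h5 : 1 < K ^ s := one_lt_pow₀ hK hs.ne'
      have h6 : 1 ≤ w0 := h1.trans h2
      nlinarith
    · linarith [h3 h4]

end CSP

/-! ### From the shattering number to the local lemma. -/

theorem ENat.exists_of_iInf_le {P : ℕ → Prop} {n : ℕ} (h : ⨅ (s : ℕ) (_ : P s), (s : ℕ∞) ≤ n) :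
    ∃ s ≤ n, P s := by
  by_contra! hcon
  have h1 : ((n + 1 : ℕ) : ℕ∞) ≤ ⨅ (s : ℕ) (_ : P s), (s : ℕ∞) := by
    refine le_iInf₂ fun s hs => ?_
    have : n + 1 ≤ s := by
      by_contra hlt
      exact hcon s (by omega) hs
    exact_mod_cast this
  have h2 : n + 1 ≤ n := by exact_mod_cast h1.trans h
  omega

namespace CSP

variable {X : Type*} [MeasurableSpace X] [StandardBorelSpace X] {q : ℕ}

/-- The equivalence relation of a Borel partition into finite sets is Borel. -/
theorem measurableSet_mem_common {𝓟 : Set (Finset X)} (h𝓟 : MeasurableSet[finsetBorel X] 𝓟)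
    (huniq : ∀ x, ∀ S ∈ 𝓟, ∀ T ∈ 𝓟, x ∈ S → x ∈ T → S = T) :
    MeasurableSet {p : X × X | ∃ S ∈ 𝓟, p.1 ∈ S ∧ p.2 ∈ S} := by
  rw [measurableSet_finsetBorel_iff] at h𝓟
  have h1 : {p : X × X | ∃ S ∈ 𝓟, p.1 ∈ S ∧ p.2 ∈ S} =
      ⋃ k : ℕ, ⋃ i : Fin k, ⋃ j : Fin k, {p |
        ∃ t : {t : Fin k → X // Function.Injective t},
          Finset.univ.map ⟨t.1, t.2⟩ ∈ 𝓟 ∧ p.1 = t.1 i ∧ p.2 = t.1 j} := by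
    ext ⟨x, y⟩
    simp only [Set.mem_ofPred_eq, Set.mem_iUnion]
    constructor
    · rintro ⟨S, hS, hx, hy⟩
      have hinj : Function.Injective fun i => (S.equivFin.symm i : X) :=
        Subtype.val_injective.comp S.equivFin.symm.injective
      refine ⟨S.card, S.equivFin ⟨x, hx⟩, S.equivFin ⟨y, hy⟩, ⟨_, hinj⟩, ?_, by simp, by simp⟩
      convert! hS
      ext z
      simp only [Finset.mem_map, Finset.mem_univ, true_and, Function.Embedding.coeFn_mk]
      exact ⟨fun ⟨i, hi⟩ => hi ▸ (S.equivFin.symm i).2, fun hz => ⟨S.equivFin ⟨z, hz⟩, by simp⟩⟩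
    · rintro ⟨k, i, j, t, ht, rfl, rfl⟩
      exact ⟨_, ht, by simp, by simp⟩
  rw [h1]
  refine MeasurableSet.iUnion fun k => MeasurableSet.iUnion fun i => MeasurableSet.iUnion fun j =>
    MeasureTheory.measurableSet_exists_of_finite
      (A := fun (p : X × X) (t : {t : Fin k → X // Function.Injective t}) =>
        Finset.univ.map ⟨t.1, t.2⟩ ∈ 𝓟 ∧ p.1 = t.1 i ∧ p.2 = t.1 j) ?_ fun p => ?_
  · refine (measurable_snd (h𝓟 k)).inter (MeasurableSet.inter ?_ ?_)
    · exact measurableSet_eq_fun (measurable_fst.comp measurable_fst)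
        ((measurable_pi_apply i).comp (measurable_subtype_coe.comp measurable_snd))
    · exact measurableSet_eq_fun (measurable_snd.comp measurable_fst)
        ((measurable_pi_apply j).comp (measurable_subtype_coe.comp measurable_snd))
  -- A member containing `p.1` is unique, so the tuples in question take values in one finite set.
  · by_cases hS : ∃ S ∈ 𝓟, p.1 ∈ S
    · obtain ⟨S, hS, hpS⟩ := hS
      refine (Set.Finite.preimage (f := Subtype.val) (s := {x : Fin k → X | ∀ i, x i ∈ S})
        Subtype.val_injective.injOn (Set.Finite.pi' fun _ => S.finite_toSet)).subset ?_
      rintro t ⟨ht, h1, -⟩ a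
      rw [huniq p.1 S hS _ ht hpS (by rw [h1]; simp)]
      simp
    · refine Set.finite_empty.subset ?_
      rintro t ⟨ht, h1, -⟩
      exact hS ⟨_, ht, by rw [h1]; simp⟩

theorem bad_eq_empty_of_p_eq_zero {X : Type*} {q : ℕ} {𝓑 : CSP X q} (hp : 𝓑.p = 0)
    {B : CSPConstraint X q} (hB : B ∈ 𝓑) : B.bad = ∅ := by
  have h1 : B.prob = 0 := by
    refine le_antisymm ?_ zero_le
    rw [← hp]
    exact le_iSup₂ (f := fun (B : CSPConstraint X q) (_ : B ∈ 𝓑) => B.prob) B hB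
  rw [CSPConstraint.prob, ENNReal.div_eq_zero_iff] at h1
  rcases h1 with h1 | h1
  · simpa using h1
  · exact absurd h1 (ENNReal.pow_ne_top (ENNReal.natCast_ne_top q))

omit [StandardBorelSpace X] in
theorem hasBorelSolution_of_p_eq_zero (hq : 0 < q) {𝓑 : CSP X q} (hp : 𝓑.p = 0) :
    𝓑.HasBorelSolution := by
  refine ⟨fun _ => ⟨0, hq⟩, measurable_const, fun B hB h => ?_⟩
  rw [CSPConstraint.Violates, bad_eq_empty_of_p_eq_zero hp hB] at h
  exact absurd h (Finset.notMem_empty _)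

theorem encard_le_of_d_eq {X : Type*} {q : ℕ} {𝓑 : CSP X q} {d : ℕ} (hd : 𝓑.d = d) :
    ∀ B ∈ 𝓑, {B' | B' ∈ 𝓑 ∧ B ≠ B' ∧ ∃ x, x ∈ B'.dom ∧ x ∈ B.dom}.encard ≤ d := by
  intro B hB
  rw [← hd]
  exact le_iSup₂ (f := fun (B : CSPConstraint X q) (_ : B ∈ 𝓑) =>
    {B' | B' ∈ 𝓑 ∧ B ≠ B' ∧ ∃ x, x ∈ B'.dom ∧ x ∈ B.dom}.encard) B hB

/-- A nonzero multiple of infinity exceeds every real bound, so an infinite degree is possible only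
when nothing is forbidden. -/
theorem p_eq_zero_of_d_eq_top {X : Type*} {q : ℕ} {𝓑 : CSP X q} (hd : 𝓑.d = ⊤) {s : ℕ}
    (hs : 0 < s) {r : ℝ} (h : 𝓑.p * ((𝓑.d : ℝ≥0∞) + 1) ^ s ≤ ENNReal.ofReal r) : 𝓑.p = 0 := by
  by_contra hp
  rw [hd, ENat.toENNReal_top, top_add, ENNReal.top_pow hs.ne', ENNReal.mul_top hp, top_le_iff] at h
  exact ENNReal.ofReal_ne_top h

theorem prob_mul_pow_le_one {X : Type*} {q : ℕ} {𝓑 : CSP X q} {d : ℕ} (hd : 𝓑.d = d)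
    {s : ℕ} (h : 𝓑.p * ((𝓑.d : ℝ≥0∞) + 1) ^ s ≤ ENNReal.ofReal (Real.exp (-(s : ℝ))))
    {B : CSPConstraint X q} (hB : B ∈ 𝓑) :
    (B.bad.card : ℝ) / (q : ℝ) ^ B.dom.card * (Real.exp 1 * (d + 1)) ^ s ≤ 1 := by
  have h1 : B.prob ≤ 𝓑.p :=
    le_iSup₂ (f := fun (B : CSPConstraint X q) (_ : B ∈ 𝓑) => B.prob) B hB
  have h2 : B.prob * ((d : ℝ≥0∞) + 1) ^ s ≤ ENNReal.ofReal (Real.exp (-(s : ℝ))) := by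
    refine le_trans ?_ h
    rw [hd, ENat.toENNReal_coe]
    gcongr
  have h3 := ENNReal.toReal_mono ENNReal.ofReal_ne_top h2
  rw [ENNReal.toReal_ofReal (Real.exp_pos _).le, CSPConstraint.prob] at h3
  simp only [ENNReal.toReal_mul, ENNReal.toReal_div, ENNReal.toReal_pow, ENNReal.toReal_natCast]
    at h3
  rw [ENNReal.toReal_add (ENNReal.natCast_ne_top d) ENNReal.one_ne_top, ENNReal.toReal_natCast,
    ENNReal.toReal_one] at h3
  have h4 : Real.exp 1 ^ s = Real.exp s := by rw [← Real.exp_nat_mul, mul_one]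
  rw [mul_pow, h4]
  calc (B.bad.card : ℝ) / (q : ℝ) ^ B.dom.card * (Real.exp s * ((d : ℝ) + 1) ^ s)
      = Real.exp s * ((B.bad.card : ℝ) / (q : ℝ) ^ B.dom.card * ((d : ℝ) + 1) ^ s) := by ring
    _ ≤ Real.exp s * Real.exp (-(s : ℝ)) := by gcongr
    _ = 1 := by rw [← Real.exp_add, add_neg_cancel, Real.exp_zero]

/-- The Borel Local Lemma in terms of the shattering number. -/
theorem hasBorelSolution_of_sh_le (hq : 0 < q) {𝓑 : CSP X q} (h𝓑 : MeasurableSet 𝓑) {s : ℕ}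
    (hs : 0 < s) (hsh : 𝓑.sh ≤ s)
    (hp : 𝓑.p * ((𝓑.d : ℝ≥0∞) + 1) ^ s ≤ ENNReal.ofReal (Real.exp (-(s : ℝ)))) :
    𝓑.HasBorelSolution := by
  by_cases hdtop : 𝓑.d = ⊤
  · exact hasBorelSolution_of_p_eq_zero hq (p_eq_zero_of_d_eq_top hdtop hs hp)
  obtain ⟨d, hd⟩ := ENat.ne_top_iff_exists.1 hdtop
  obtain ⟨s', hs', 𝓟, h𝓟m, ⟨-, h𝓟⟩, h𝓟B⟩ := ENat.exists_of_iInf_le hsh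
  have huniq : ∀ x, ∀ S ∈ 𝓟, ∀ T ∈ 𝓟, x ∈ S → x ∈ T → S = T := by
    intro x S hS T hT hxS hxT
    obtain ⟨_, -, h⟩ := h𝓟 x
    have h1 := h S ⟨⟨S, hS, rfl⟩, hxS⟩
    have h2 := h T ⟨⟨T, hT, rfl⟩, hxT⟩
    exact Finset.coe_injective (h1.trans h2.symm)
  have hex : ∀ x, ∃ S ∈ 𝓟, x ∈ S := by
    intro x
    obtain ⟨_, ⟨⟨S, hS, rfl⟩, hx⟩, -⟩ := h𝓟 x
    exact ⟨S, hS, hx⟩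
  refine hasBorelSolution_of_equivalence hq h𝓑 (encard_le_of_d_eq hd.symm)
    (E := fun x y => ∃ S ∈ 𝓟, x ∈ S ∧ y ∈ S) ⟨fun x => ?_, ?_, ?_⟩
    (measurableSet_mem_common h𝓟m huniq) (fun x => ?_) hs (fun B hB T hT hTE => ?_)
    fun B hB => prob_mul_pow_le_one hd.symm hp hB
  · obtain ⟨S, hS, hx⟩ := hex x
    exact ⟨S, hS, hx, hx⟩
  · rintro x y ⟨S, hS, hx, hy⟩
    exact ⟨S, hS, hy, hx⟩
  · rintro x y z ⟨S, hS, hx, hy⟩ ⟨T, hT, hy', hz⟩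
    rw [huniq y S hS T hT hy hy'] at hx
    exact ⟨T, hT, hx, hz⟩
  · obtain ⟨S, hS, hx⟩ := hex x
    refine S.finite_toSet.subset ?_
    rintro y ⟨T, hT, hx', hy⟩
    rw [huniq x S hS T hT hx hx']
    exact hy
  · choose pc hpc1 hpc2 using hex
    have h1 : (T : Set X).encard ≤ {S | S ∈ 𝓟 ∧ ∃ x, x ∈ B.dom ∧ x ∈ S}.encard := by
      refine Set.encard_le_encard_of_injOn (f := pc)
        (fun x hx => ⟨hpc1 x, x, hT hx, hpc2 x⟩) ?_
      intro x hx y hy hxy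
      refine hTE x hx y hy ⟨pc x, hpc1 x, hpc2 x, ?_⟩
      rw [hxy]
      exact hpc2 y
    have h2 := h1.trans (h𝓟B B hB)
    rw [Set.encard_coe_eq_coe_finsetCard] at h2
    exact (by exact_mod_cast h2 : T.card ≤ s').trans hs'

end CSP

/-! ### Finite components and the separation index. -/

section Components

variable {X : Type*} [MeasurableSpace X] [StandardBorelSpace X]

/-- The reflexive transitive closure of a Borel relation is Borel, provided that its sections are
finite. -/
theorem measurableSet_reflTransGen {H : X → X → Prop} (hH : MeasurableSet {p : X × X | H p.1 p.2})
    (hfin : ∀ x, {y | Relation.ReflTransGen H x y}.Finite) :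
    MeasurableSet {p : X × X | Relation.ReflTransGen H p.1 p.2} := by
  -- Reachability in exactly `n` steps: its sections lie in those of the closure, so they are finite
  -- and composition with `H` stays Borel.
  let R : ℕ → X → X → Prop := fun n =>
    Nat.rec (fun x y => x = y) (fun _ R x z => ∃ y, R x y ∧ H y z) n
  have hR : ∀ n x y, R n x y → Relation.ReflTransGen H x y := by
    intro n
    induction n with
    | zero => rintro x y rfl; exact Relation.ReflTransGen.refl
    | succ n ih => rintro x z ⟨y, h1, h2⟩; exact (ih x y h1).tail h2
  have hRm : ∀ n, MeasurableSet {p : X × X | R n p.1 p.2} := by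
    intro n
    induction n with
    | zero => exact measurableSet_eq_fun measurable_fst measurable_snd
    | succ n ih =>
      exact measurableSet_comp_of_finite ih (fun x => (hfin x).subset fun y hy => hR n x y hy) hH
  have : {p : X × X | Relation.ReflTransGen H p.1 p.2} = ⋃ n, {p | R n p.1 p.2} := by
    ext ⟨x, y⟩
    simp only [Set.mem_ofPred_eq, Set.mem_iUnion]
    constructor
    · intro h
      induction h with
      | refl => exact ⟨0, rfl⟩
      | tail _ h2 ih =>
        obtain ⟨n, hn⟩ := ih
        exact ⟨n + 1, _, hn, h2⟩
    · rintro ⟨n, hn⟩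
      exact hR n x y hn
  rw [this]
  exact MeasurableSet.iUnion hRm

/-- The classes of a finite Borel equivalence relation form a Borel set of finite sets. -/
theorem measurableSet_classes {E : X → X → Prop} (hEm : MeasurableSet {p : X × X | E p.1 p.2})
    (hEfin : ∀ x, {y | E x y}.Finite) :
    MeasurableSet[finsetBorel X] {S : Finset X | S.Nonempty ∧ ∀ x ∈ S, ∀ y, E x y ↔ y ∈ S} := by
  rw [measurableSet_finsetBorel_iff]
  intro k
  have h1 : {t : {t : Fin k → X // Function.Injective t} |
      (Finset.univ : Finset (Fin k)).map ⟨t.1, t.2⟩ ∈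
        {S : Finset X | S.Nonempty ∧ ∀ x ∈ S, ∀ y, E x y ↔ y ∈ S}} =
      {_t | 0 < k} ∩ ⋂ i, ((⋂ j, {t | E (t.1 i) (t.1 j)}) ∩
        {t | ∃ y, E (t.1 i) y ∧ ∀ j, t.1 j ≠ y}ᶜ) := by
    ext t
    have e1 : ((Finset.univ : Finset (Fin k)).map ⟨t.1, t.2⟩).Nonempty ↔ 0 < k := by
      rw [Finset.map_nonempty, Finset.univ_nonempty_iff, Fin.pos_iff_nonempty]
    have e2 : ∀ y, y ∈ (Finset.univ : Finset (Fin k)).map ⟨t.1, t.2⟩ ↔ ∃ j, t.1 j = y := by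
      intro y; simp
    simp only [Set.mem_ofPred_eq, e1, e2, Set.mem_inter_iff, Set.mem_iInter, Set.mem_compl_iff,
      not_exists, not_and, forall_exists_index, forall_apply_eq_imp_iff]
    refine and_congr_right fun _ => forall_congr' fun i => ?_
    constructor
    · intro h
      exact ⟨fun j => (h _).2 ⟨j, rfl⟩, fun y hy hj => by
        obtain ⟨j, hj'⟩ := (h y).1 hy
        exact hj j hj'⟩
    · rintro ⟨h1, h2⟩ y
      refine ⟨fun hy => ?_, ?_⟩
      · by_contra hcon
        exact h2 y hy fun j hj => hcon ⟨j, hj⟩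
      · rintro ⟨j, rfl⟩
        exact h1 j
  rw [h1]
  have hev : ∀ i : Fin k, Measurable fun t : {t : Fin k → X // Function.Injective t} => t.1 i :=
    fun i => (measurable_pi_apply i).comp measurable_subtype_coe
  refine (MeasurableSet.const _).inter (MeasurableSet.iInter fun i => MeasurableSet.inter
    (MeasurableSet.iInter fun j => ((hev i).prodMk (hev j)) hEm) (MeasurableSet.compl ?_))
  refine MeasureTheory.measurableSet_exists_of_finite
    (A := fun (t : {t : Fin k → X // Function.Injective t}) y => E (t.1 i) y ∧ ∀ j, t.1 j ≠ y)
    ?_ fun t => (hEfin (t.1 i)).subset fun y hy => hy.1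
  have h2 : {p : {t : Fin k → X // Function.Injective t} × X |
      E (p.1.1 i) p.2 ∧ ∀ j, p.1.1 j ≠ p.2} =
      {p | E (p.1.1 i) p.2} ∩ ⋂ j, {p | p.1.1 j = p.2}ᶜ := by
    ext p
    simp
  rw [h2]
  exact ((((hev i).comp measurable_fst).prodMk measurable_snd) hEm).inter
    (MeasurableSet.iInter fun j =>
      (measurableSet_eq_fun ((hev j).comp measurable_fst) measurable_snd).compl)

end Components

namespace CSP

variable {X : Type*} [MeasurableSpace X] [StandardBorelSpace X] {q : ℕ}

/-- Points of one domain lying in the same piece are equal or adjacent, hence in one component of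
that piece; so a domain meets at most one component for each of the `s + 1` pieces. -/
theorem isShatteredBy_of_isSeparatedBy {𝓑 : CSP X q} (hG : 𝓑.graph.IsBorel) {s : ℕ}
    (hs : 𝓑.graph.IsSeparatedBy s) : 𝓑.IsShatteredBy (s + 1) := by
  obtain ⟨U, hUm, hUd, hUu, hUc⟩ := hs
  have hUniq : ∀ x i j, x ∈ U i → x ∈ U j → i = j := by
    intro x i j hi hj
    by_contra hij
    exact Set.disjoint_left.1 (hUd i j hij) hi hj
  let H : X → X → Prop := fun x y => 𝓑.graph.Adj x y ∧ ∃ i, x ∈ U i ∧ y ∈ U i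
  have hHm : MeasurableSet {p : X × X | H p.1 p.2} := by
    have h1 : {p : X × X | ∃ i, p.1 ∈ U i ∧ p.2 ∈ U i} = ⋃ i, U i ×ˢ U i := by
      ext p; simp
    have h2 : MeasurableSet {p : X × X | ∃ i, p.1 ∈ U i ∧ p.2 ∈ U i} := by
      rw [h1]
      exact MeasurableSet.iUnion fun i => (hUm i).prod (hUm i)
    exact MeasurableSet.inter hG h2
  let E := Relation.ReflTransGen H
  have hreach : ∀ x y, E x y → ∀ i (hx : x ∈ U i), ∃ hy : y ∈ U i,
      (𝓑.graph.induce (U i)).Reachable ⟨x, hx⟩ ⟨y, hy⟩ := by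
    intro x y h
    induction h with
    | refl => exact fun i hx => ⟨hx, SimpleGraph.Reachable.refl _⟩
    | tail _ h2 ih =>
      intro i hx
      obtain ⟨hy, hr⟩ := ih i hx
      obtain ⟨hadj, j, h3, h4⟩ := h2
      have hij : j = i := hUniq _ _ _ h3 hy
      subst hij
      refine ⟨h4, hr.trans (SimpleGraph.Adj.reachable ?_)⟩
      exact hadj
  have hEfin : ∀ x, {y | E x y}.Finite := by
    intro x
    obtain ⟨i, hi⟩ : ∃ i, x ∈ U i := by
      have : x ∈ ⋃ i, U i := hUu ▸ Set.mem_univ x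
      simpa using this
    have := (hUc i ((𝓑.graph.induce (U i)).connectedComponentMk ⟨x, hi⟩)).image Subtype.val
    refine this.subset fun y hy => ?_
    obtain ⟨hyU, hr⟩ := hreach x y hy i hi
    exact ⟨⟨y, hyU⟩, SimpleGraph.ConnectedComponent.sound hr.symm, rfl⟩
  have hEm : MeasurableSet {p : X × X | E p.1 p.2} := measurableSet_reflTransGen hHm hEfin
  have : Std.Symm H := ⟨fun x y ⟨h, i, h1, h2⟩ => ⟨h.symm, i, h2, h1⟩⟩
  have hEsymm : ∀ {x y}, E x y → E y x := fun h => Relation.ReflTransGen.stdSymm.symm _ _ h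
  let cl : X → Finset X := fun x => (hEfin x).toFinset
  have hcl : ∀ x y, y ∈ cl x ↔ E x y := fun x y => (hEfin x).mem_toFinset
  refine ⟨_, measurableSet_classes hEm hEfin, ⟨?_, fun x => ?_⟩, fun B hB => ?_⟩
  · rintro ⟨S, ⟨hS, -⟩, h⟩
    exact hS.ne_empty (Finset.coe_eq_empty.1 h)
  · refine ⟨cl x, ⟨⟨cl x, ⟨⟨x, (hcl x x).2 .refl⟩, fun y hy z => ?_⟩, rfl⟩, (hcl x x).2 .refl⟩, ?_⟩
    · rw [hcl] at hy ⊢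
      exact ⟨fun h => hy.trans h, fun h => (hEsymm hy).trans h⟩
    · rintro _ ⟨⟨S, ⟨-, hS⟩, rfl⟩, hxS⟩
      ext y
      rw [Finset.mem_coe, Finset.mem_coe, hcl]
      exact (hS x hxS y).symm
  · set 𝓒 := {S | S ∈ {S : Finset X | S.Nonempty ∧ ∀ x ∈ S, ∀ y, E x y ↔ y ∈ S} ∧
      ∃ x, x ∈ B.dom ∧ x ∈ S} with h𝓒
    -- Each component met by the domain is sent to a piece containing a common point; index 0 is a
    -- default for other sets.
    have hidx : ∀ S : Finset X, ∃ i : Fin (s + 1), S ∈ 𝓒 → ∃ x, x ∈ B.dom ∧ x ∈ S ∧ x ∈ U i := by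
      intro S
      by_cases hS : S ∈ 𝓒
      · obtain ⟨x, hx, hxS⟩ := hS.2
        have : x ∈ ⋃ i, U i := hUu ▸ Set.mem_univ x
        obtain ⟨i, hi⟩ := Set.mem_iUnion.1 this
        exact ⟨i, fun _ => ⟨x, hx, hxS, hi⟩⟩
      · exact ⟨0, fun h => absurd h hS⟩
    choose idx hidx using hidx
    have h1 : 𝓒.encard ≤ (Set.univ : Set (Fin (s + 1))).encard := by
      refine Set.encard_le_encard_of_injOn (f := idx) (fun _ _ => Set.mem_univ _) ?_
      intro S hS T hT hST
      obtain ⟨x, hx, hxS, hxU⟩ := hidx S hS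
      obtain ⟨y, hy, hyT, hyU⟩ := hidx T hT
      rw [← hST] at hyU
      have hxy : E x y := by
        by_cases h : x = y
        · rw [h]
        · exact .single ⟨⟨h, B, hB, hx, hy⟩, _, hxU, hyU⟩
      ext z
      rw [← hS.1.2 x hxS z, ← hT.1.2 y hyT z]
      exact ⟨fun h => (hEsymm hxy).trans h, fun h => hxy.trans h⟩
    refine h1.trans (le_of_eq ?_)
    simp

theorem sh_le_si_add_one {𝓑 : CSP X q} (hG : 𝓑.graph.IsBorel) : 𝓑.sh ≤ 𝓑.graph.si + 1 := by
  by_cases h : 𝓑.graph.si = ⊤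
  · rw [h]; simp
  obtain ⟨n, hn⟩ := ENat.ne_top_iff_exists.1 h
  obtain ⟨s, hsn, hs⟩ := ENat.exists_of_iInf_le (P := 𝓑.graph.IsSeparatedBy) (n := n) hn.symm.le
  rw [← hn]
  refine (iInf₂_le (s + 1) (isShatteredBy_of_isSeparatedBy hG hs)).trans ?_
  exact_mod_cast Nat.succ_le_succ hsn

/-- With finitely many constraints at each point the quantifier over constraints has finite
sections, so the last two parts need no assumption that the graph is Borel. -/
theorem graph_isBorel {𝓑 : CSP X q} (h𝓑 : MeasurableSet 𝓑)
    (hfin : ∀ x, {B | B ∈ 𝓑 ∧ x ∈ B.dom}.Finite) : 𝓑.graph.IsBorel :=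
  (measurableSet_eq_fun measurable_fst measurable_snd).compl.inter
    (measurableSet_exists_mem_dom h𝓑 hfin)

/-- The Borel Local Lemma in terms of the separation index. -/
theorem hasBorelSolution_of_si_le (hq : 0 < q) {𝓑 : CSP X q} (h𝓑 : MeasurableSet 𝓑) {s : ℕ}
    (hsi : 𝓑.graph.si ≤ s)
    (hp : 𝓑.p * ((𝓑.d : ℝ≥0∞) + 1) ^ (s + 1) ≤ ENNReal.ofReal (Real.exp (-(s : ℝ) - 1))) :
    𝓑.HasBorelSolution := by
  by_cases hdtop : 𝓑.d = ⊤
  · exact hasBorelSolution_of_p_eq_zero hq (p_eq_zero_of_d_eq_top hdtop s.succ_pos hp)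
  obtain ⟨d, hd⟩ := ENat.ne_top_iff_exists.1 hdtop
  have hG := graph_isBorel h𝓑 (finite_mem_dom (encard_le_of_d_eq hd.symm))
  refine hasBorelSolution_of_sh_le hq h𝓑 s.succ_pos ?_ ?_
  · rw [Nat.cast_succ]
    exact (sh_le_si_add_one hG).trans (by gcongr)
  · have : -((s + 1 : ℕ) : ℝ) = -(s : ℝ) - 1 := by push_cast; ring
    rw [this]
    exact hp

end CSP

theorem SimpleGraph.distPower_one {V : Type*} (G : SimpleGraph V) : G.distPower 1 = G := by
  ext u v
  constructor
  · rintro ⟨hne, w, -, hw⟩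
    cases w with
    | nil => exact absurd rfl hne
    | cons h w' =>
      cases w' with
      | nil => exact h
      | cons h' w'' => simp at hw
  · intro h
    exact ⟨h.ne, h.toWalk, by simp [h.ne], by simp⟩

theorem SimpleGraph.si_le_asi {V : Type*} [MeasurableSpace V] (G : SimpleGraph V) :
    G.si ≤ G.asi := by
  have := le_iSup (fun R : ℕ => (G.distPower R).si) 1
  rwa [SimpleGraph.distPower_one] at this

theorem theorem3p3 {X : Type*} [MeasurableSpace X] [StandardBorelSpace X] {q : ℕ} (hq : 0 < q)
    (𝓑 : CSP X q) (h𝓑 : MeasurableSet 𝓑) :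
    (∀ s : ℕ, 0 < s → 𝓑.sh ≤ (s : ℕ∞) →
      𝓑.p * ((𝓑.d : ℝ≥0∞) + 1) ^ s ≤ ENNReal.ofReal (Real.exp (-(s : ℝ))) →
      𝓑.HasBorelSolution) ∧
    (𝓑.graph.IsBorel → 𝓑.sh ≤ 𝓑.graph.si + 1) ∧
    (∀ s : ℕ, 𝓑.graph.si ≤ (s : ℕ∞) →
      𝓑.p * ((𝓑.d : ℝ≥0∞) + 1) ^ (s + 1) ≤ ENNReal.ofReal (Real.exp (-(s : ℝ) - 1)) →
      𝓑.HasBorelSolution) ∧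
    (𝓑.graph.asi ≤ 1 →
      𝓑.p * ((𝓑.d : ℝ≥0∞) + 1) ^ 2 ≤ ENNReal.ofReal (Real.exp (-2)) →
      𝓑.HasBorelSolution) := by
  refine ⟨fun s hs hsh hp => CSP.hasBorelSolution_of_sh_le hq h𝓑 hs hsh hp,
    CSP.sh_le_si_add_one, fun s hsi hp => CSP.hasBorelSolution_of_si_le hq h𝓑 hsi hp,
    fun hasi hp => CSP.hasBorelSolution_of_si_le hq h𝓑 (s := 1) ?_ ?_⟩
  · exact (SimpleGraph.si_le_asi _).trans (by simpa using hasi)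
  · have : -((1 : ℕ) : ℝ) - 1 = -2 := by norm_num
    rw [this]
    exact hp
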